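/- **Setting.** Let $h\ge 1$, $n,m\ge 0$ be integers and consider the coordinates $t$, $x_1,\dots,x_n$ and $u^k_{s,I}$ ($1\le k\le m$, $0\le s<h$, $I\in\mathbb Z_{\ge0}^n$), where $u^k_{s,I}$ stands for $\partial^{s+|I|}u^k/\partial t^s\partial x^I$. Let $\mathcal F_{\mathcal E}$ be the algebra of smooth real functions on a fixed open domain of the space of these coordinates (with the product topology), each function depending on finitely many coordinates. Let $F=(F^1,\dots,F^m)$, $F^i\in\mathcal F_{\mathcal E}$, depend only on $t$, $x_j$, the pure space derivatives $u^k_{0,I}$ and the pure time derivatives $u^k_{s,0}$, $s<h$, and consider the system of generalized evolution form $$\frac{\partial^h u^i}{\partial t^h}=F^i,\qquad i=1,\dots,m .$$ On $\mathcal F_{\mathcal E}$ we have the total derivatives restricted to the system, $$\bar D_{x_i}=\frac{\partial}{\partial x_i}+\sum_{k,s,I}u^k_{s,I+1_i}\frac{\partial}{\partial u^k_{s,I}},\qquad \bar D_t=\frac{\partial}{\partial t}+\sum_{k,I,\,s<h-1}u^k_{s+1,I}\frac{\partial}{\partial u^k_{s,I}}+\sum_{k,I}\bar D_x^I(F^k)\frac{\partial}{\partial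 u^k_{h-1,I}} .$$ *Order and symbol.* For a vector-function $f$ with components in $\mathcal F_{\mathcal E}$, $\mathrm o(f)$ is the largest $|I|$ with some $\partial f/\partial u^k_{s,I}\ne0$, and $\mathrm o(f)=-1$ if there is none; if $\mathrm o(f)\ge 0$, $\mathrm t(f)$ is the largest $s$ with $\partial f/\partial u^k_{s,I}\neq 0$ for some $k$ and some $|I|=\mathrm o(f)$. The symbol $\mathbf S_f$ is the matrix with the entries $[\mathbf S_f]_{ij}=\sum_{|I|=\mathrm o(f)}\frac{\partial f_i}{\partial u^j_{\mathrm t(f),I}}\,q^I\in\mathcal F_{\mathcal E}[q_1,\dots,q_n]$. Put $N=\mathrm o(F)$, assume $N>0$, and let $A=\mathbf S_F$. *The constant $O$.* Let $L$ be the $m\times m$ matrix differential operator $$[L]_{ij}=\sum_I(-1)^{|I|}\bar D_x^I\circ\frac{\partial F^j}{\partial u^i_{0,I}}+\sum_{s=1}^{h-1}(-1)^s\bar D_t^s\circ\frac{\partial F^j}{\partial u^i_{s,0}},$$ so that $(-1)^h\bar D_t^h-L$ is the adjoint of the linearization of the system. *Conservation laws.* A conserved current is a tuple $(J_0,\dots,J_n)$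 of elements of $\mathcal F_{\mathcal E}$ with $\bar D_tJ_0+\sum_i\bar D_{x_i}J_i=0$. On the space of all jets (coordinates $t,x_j,u^k_{s,I}$, all $s\ge0$) over the domain, let $D_t,D_{x_i}$ be the usual total derivatives and $\mathcal I$ the ideal of smooth functions (of finitely many coordinates) generated by all $D_t^sD_x^I(u^k_{h,0}-F^k)$; modulo $\mathcal I$, every function equals a unique element of $\mathcal F_{\mathcal E}$. If $\tilde J_i$ are representatives of the $J_i$ modulo $\mathcal I$ and $$D_t\tilde J_0+\sum_iD_{x_i}\tilde J_i=\sum_{k,s,I}g^k_{s,I}\,D_t^sD_x^I(u^k_{h,0}-F^k)$$ (a finite sum), then $\chi=(\chi_1,\dots,\chi_m)$, where $\chi_k\in\mathcal F_{\mathcal E}$ is the class of $\sum_{s,I}(-1)^{s+|I|}D_t^sD_x^I(g^k_{s,I})$ modulo $\mathcal I$, is called the characteristic of the conservation law given by $(J_0,\dots,J_n)$. **Theorem.** The operators $[L]_{ij}$ can be uniquely written in the form $[L]_{ij}=\sum_{|I|\le N}f_I^{ij}\bar D_x^I+\sum_{1\le s<h}g_s^{ij}\bar D_t^s$ with coefficients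 in $\mathcal F_{\mathcal E}$, and $$O=\max_{i,j,I,s}\{-1,\ \mathrm o(f_I^{ij})-N,\ \mathrm o(g_s^{ij})-N\}$$ satisfies $O\le N$. If $\chi$ is the characteristic of a conservation law of the system and $\mathrm o(\chi)>O$, then $$\mathbf S_\chi A=(-1)^{N+h}A^{t}\,\mathbf S_\chi .$$ -/

import Mathlib

open scoped ContDiff

noncomputable section

namespace JetCons

/-! ### Smooth functions of finitely many of (possibly infinitely many) variables -/

/-- The algebra of smooth real functions on an open set `U` of `ℝ^ι` (product topology), each of
which depends on finitely many of the variables only. -/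
def SmoothFn {ι : Type} (U : TopologicalSpace.Opens (ι → ℝ)) : Subalgebra ℝ (U → ℝ) where
  carrier := {f | ∃ (S : Finset ι) (g : (S → ℝ) → ℝ),
    ContDiffOn ℝ ∞ g (S.restrict '' (U : Set (ι → ℝ))) ∧ ∀ θ : U, f θ = g (S.restrict θ.1)}
  mul_mem' := by
    classical
    rintro f₁ f₂ ⟨S, g, hg, hf⟩ ⟨T, k, hk, hf'⟩
    refine ⟨S ∪ T, fun y : ((S ∪ T : Finset ι) → ℝ) => g (Finset.restrict₂ (π := fun _ => ℝ) Finset.subset_union_left y) *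
      k (Finset.restrict₂ (π := fun _ => ℝ) Finset.subset_union_right y), ContDiffOn.mul ?_ ?_, ?_⟩
    · refine hg.comp (contDiff_pi.2 fun i => contDiff_apply ℝ ℝ _).contDiffOn ?_
      rintro _ ⟨θ, hθ, rfl⟩
      exact ⟨θ, hθ, rfl⟩
    · refine hk.comp (contDiff_pi.2 fun i => contDiff_apply ℝ ℝ _).contDiffOn ?_
      rintro _ ⟨θ, hθ, rfl⟩
      exact ⟨θ, hθ, rfl⟩
    · intro θ
      simp only [Pi.mul_apply, hf, hf']
      rfl
  add_mem' := by
    classical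
    rintro f₁ f₂ ⟨S, g, hg, hf⟩ ⟨T, k, hk, hf'⟩
    refine ⟨S ∪ T, fun y : ((S ∪ T : Finset ι) → ℝ) => g (Finset.restrict₂ (π := fun _ => ℝ) Finset.subset_union_left y) +
      k (Finset.restrict₂ (π := fun _ => ℝ) Finset.subset_union_right y), ContDiffOn.add ?_ ?_, ?_⟩
    · refine hg.comp (contDiff_pi.2 fun i => contDiff_apply ℝ ℝ _).contDiffOn ?_
      rintro _ ⟨θ, hθ, rfl⟩
      exact ⟨θ, hθ, rfl⟩
    · refine hk.comp (contDiff_pi.2 fun i => contDiff_apply ℝ ℝ _).contDiffOn ?_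
      rintro _ ⟨θ, hθ, rfl⟩
      exact ⟨θ, hθ, rfl⟩
    · intro θ
      simp only [Pi.add_apply, hf, hf']
      rfl
  algebraMap_mem' r := ⟨∅, fun _ => r, contDiffOn_const, fun _ => rfl⟩

/-- A coordinate as a smooth function on `U`. -/
def coordFn {ι : Type} {U : TopologicalSpace.Opens (ι → ℝ)} (c : ι) : SmoothFn U :=
  ⟨fun θ => θ.1 c, {c}, fun y => y ⟨c, Finset.mem_singleton_self c⟩,
    (contDiff_apply ℝ ℝ _).contDiffOn, fun _ => rfl⟩

open Classical in
/-- The partial derivative with respect to the coordinate `c`, on plain functions on `U`. -/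
def pdFun {ι : Type} {U : TopologicalSpace.Opens (ι → ℝ)} (c : ι) (f : U → ℝ) : U → ℝ :=
  fun θ => deriv (fun r : ℝ =>
    if hr : Function.update θ.1 c r ∈ U then f ⟨Function.update θ.1 c r, hr⟩ else 0) (θ.1 c)

theorem isOpen_restrict_image {ι : Type} (U : TopologicalSpace.Opens (ι → ℝ)) (S : Finset ι) :
    IsOpen (S.restrict '' (U : Set (ι → ℝ))) := by
  classical
  rw [isOpen_iff_mem_nhds]
  rintro _ ⟨θ, hθ, rfl⟩
  let e : (S → ℝ) → (ι → ℝ) := fun y i => if h : i ∈ S then y ⟨i, h⟩ else θ i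
  have he : Continuous e := by
    refine continuous_pi fun i => ?_
    by_cases h : i ∈ S
    · simp only [e, h, dite_true]; exact continuous_apply _
    · simp only [e, h, dite_false]; exact continuous_const
  have he0 : e (S.restrict θ) = θ := by
    funext i; simp [e]
  have hmem : e ⁻¹' (U : Set (ι → ℝ)) ∈ nhds (S.restrict θ) := by
    apply he.continuousAt.preimage_mem_nhds
    rw [he0]; exact U.isOpen.mem_nhds hθ
  refine Filter.mem_of_superset hmem fun y hy => ⟨e y, hy, ?_⟩
  funext i
  simp [e]

theorem pdFun_mem {ι : Type} {U : TopologicalSpace.Opens (ι → ℝ)} (c : ι) {f : U → ℝ}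
    (hf : f ∈ SmoothFn U) : pdFun c f ∈ SmoothFn U := by
  classical
  obtain ⟨S, g, hg, hfg⟩ := hf
  have hopen := isOpen_restrict_image U S
  have hev : ∀ θ : U, (fun r : ℝ => if hr : Function.update θ.1 c r ∈ U
      then f ⟨Function.update θ.1 c r, hr⟩ else 0) =ᶠ[nhds (θ.1 c)]
      fun r => g (S.restrict (Function.update θ.1 c r)) := by
    intro θ
    have hc : Continuous fun r : ℝ => Function.update θ.1 c r :=
      continuous_const.update c continuous_id
    have : ∀ᶠ r in nhds (θ.1 c), Function.update θ.1 c r ∈ (U : Set (ι → ℝ)) := by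
      apply hc.continuousAt.eventually_mem
      rw [Function.update_eq_self]; exact U.isOpen.mem_nhds θ.2
    filter_upwards [this] with r hr
    have hr' : Function.update θ.1 c r ∈ U := hr
    simp only [hr', dite_true]
    exact hfg _
  by_cases hcS : c ∈ S
  · refine ⟨S, fun y => fderiv ℝ g y (Pi.single ⟨c, hcS⟩ 1), ?_, ?_⟩
    · exact (hg.fderiv_of_isOpen hopen (by simp)).clm_apply contDiffOn_const
    · intro θ
      simp only [pdFun, (hev θ).deriv_eq]
      have hup : ∀ r, S.restrict (Function.update θ.1 c r)
          = Function.update (S.restrict θ.1) ⟨c, hcS⟩ r := by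
        intro r
        funext i
        by_cases hi : i = ⟨c, hcS⟩
        · subst hi; simp
        · have : (i : ι) ≠ c := fun h => hi (Subtype.ext h)
          simp [hi, this]
      simp only [hup]
      have hd : DifferentiableAt ℝ g (S.restrict θ.1) :=
        (hg.contDiffAt (hopen.mem_nhds ⟨θ.1, θ.2, rfl⟩)).differentiableAt (by simp)
      have hu := hasDerivAt_update (S.restrict θ.1) ⟨c, hcS⟩ (θ.1 c)
      have hd' : HasFDerivAt g (fderiv ℝ g (S.restrict θ.1))
          (Function.update (S.restrict θ.1) ⟨c, hcS⟩ (θ.1 c)) := by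
        have : Function.update (S.restrict θ.1) ⟨c, hcS⟩ (θ.1 c) = S.restrict θ.1 :=
          Function.update_eq_self (⟨c, hcS⟩ : S) (S.restrict θ.1)
        rw [this]; exact hd.hasFDerivAt
      exact (hd'.comp_hasDerivAt (θ.1 c) hu).deriv
  · refine ⟨∅, fun _ => 0, contDiffOn_const, ?_⟩
    intro θ
    simp only [pdFun, (hev θ).deriv_eq]
    have hup : ∀ r, S.restrict (Function.update θ.1 c r) = S.restrict θ.1 := by
      intro r
      funext i
      have : (i : ι) ≠ c := fun h => hcS (h ▸ i.2)
      simp [this]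
    simp only [hup, deriv_const]

/-- The partial derivative `∂f/∂c` of a smooth function of finitely many variables. -/
def pd {ι : Type} {U : TopologicalSpace.Opens (ι → ℝ)} (c : ι) (f : SmoothFn U) : SmoothFn U :=
  ⟨pdFun c f.1, pdFun_mem c f.2⟩

/-- The first order operator `∑_c w_c ∂/∂c`; on each function the sum is finite. -/
def vf {ι : Type} {U : TopologicalSpace.Opens (ι → ℝ)} (w : ι → SmoothFn U) (f : SmoothFn U) :
    SmoothFn U :=
  ∑ᶠ c, w c * pd c f

/-! ### Jet coordinates and total derivatives -/

/-- The coordinates `t`, `x_j` and `u^k_{s,I}`, where `s` (in `σ`) counts the `t`-derivatives and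
the multi-index `I` the space derivatives. All jets: `σ = ℕ`. Solutions of a system with
left-hand side `∂^h u / ∂t^h`: `σ = Fin h`. -/
inductive Coord (n m : ℕ) (σ : Type) : Type
  | t : Coord n m σ
  | x (j : Fin n) : Coord n m σ
  | u (k : Fin m) (s : σ) (I : Fin n →₀ ℕ) : Coord n m σ

variable {n m h : ℕ}

/-- `D_{x_j} = ∂/∂x_j + ∑ u^k_{s,I+1_j} ∂/∂u^k_{s,I}`. -/
def Dx {σ : Type} {U : TopologicalSpace.Opens (Coord n m σ → ℝ)} (j : Fin n) :
    SmoothFn U → SmoothFn U :=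
  vf fun
    | Coord.t => 0
    | Coord.x i => if i = j then 1 else 0
    | Coord.u k s I => coordFn (Coord.u k s (I + Finsupp.single j 1))

/-- `D_x^I = D_{x_1}^{i_1} ⋯ D_{x_n}^{i_n}`. -/
def DxI {σ : Type} {U : TopologicalSpace.Opens (Coord n m σ → ℝ)} (I : Fin n →₀ ℕ)
    (f : SmoothFn U) : SmoothFn U :=
  (List.finRange n).foldr (fun j g => (Dx j)^[I j] g) f

/-- The total `t`-derivative `D_t` on the space of all jets. -/
def Dt {U : TopologicalSpace.Opens (Coord n m ℕ → ℝ)} : SmoothFn U → SmoothFn U :=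
  vf fun
    | Coord.t => 1
    | Coord.x _ => 0
    | Coord.u k s I => coordFn (Coord.u k (s + 1) I)

/-- The restricted total `t`-derivative `D̄_t` for the system `u^k_{h,0} = F^k`, in the coordinates
`t, x_j, u^k_{s,I}`, `s < h`. -/
def DtBar {U : TopologicalSpace.Opens (Coord n m (Fin h) → ℝ)} (F : Fin m → SmoothFn U) :
    SmoothFn U → SmoothFn U :=
  vf fun
    | Coord.t => 1
    | Coord.x _ => 0
    | Coord.u k s I =>
        if hs : s.1 + 1 < h then coordFn (Coord.u k ⟨s.1 + 1, hs⟩ I) else DxI I (F k)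

/-- `∂f/∂u^k_{s,I}` for a function of the coordinates with `s < h` (zero for `s ≥ h`). -/
def pdu {U : TopologicalSpace.Opens (Coord n m (Fin h) → ℝ)} (k : Fin m) (s : ℕ)
    (I : Fin n →₀ ℕ) (f : SmoothFn U) : SmoothFn U :=
  if hs : s < h then pd (Coord.u k ⟨s, hs⟩ I) f else 0

/-! ### Systems of generalized evolution form -/

/-- The right-hand sides depend only on `t`, `x_j`, the pure space derivatives `u^k_{0,I}` and the
pure time derivatives `u^k_{s,0}`, `s < h`. -/
def IsGenEvolution {U : TopologicalSpace.Opens (Coord n m (Fin h) → ℝ)}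
    (F : Fin m → SmoothFn U) : Prop :=
  ∀ i k s I, s ≠ 0 → I ≠ 0 → pdu k s I (F i) = 0

/-! ### Order and symbol -/

/-- The order `o(f)` of a vector-function with respect to the space variables
(`-1` if it depends on `t`, `x_j` only). -/
def order {p : ℕ} {U : TopologicalSpace.Opens (Coord n m (Fin h) → ℝ)} (f : Fin p → SmoothFn U) :
    ℤ :=
  sSup ({-1} ∪ {r : ℤ | ∃ i k s I, pdu k s I (f i) ≠ 0 ∧ r = (I.degree : ℤ)})

/-- The maximal `s < h` with `∂f/∂u^k_{s,I} ≠ 0` for some `k` and some `|I| = o(f)`. -/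
def tOrder {p : ℕ} {U : TopologicalSpace.Opens (Coord n m (Fin h) → ℝ)} (f : Fin p → SmoothFn U) :
    ℕ :=
  sSup {s : ℕ | ∃ i k I, pdu k s I (f i) ≠ 0 ∧ (I.degree : ℤ) = order f}

/-- The `p × m` matrix with entries `∑_{|I| = a} (∂f_i/∂u^j_{b,I}) q^I`. -/
def symbolAt {p : ℕ} {U : TopologicalSpace.Opens (Coord n m (Fin h) → ℝ)} (a b : ℕ)
    (f : Fin p → SmoothFn U) : Matrix (Fin p) (Fin m) (MvPolynomial (Fin n) (SmoothFn U)) :=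
  Matrix.of fun i j =>
    ∑ I ∈ Finset.finsuppAntidiag Finset.univ a, MvPolynomial.monomial I (pdu j b I (f i))

/-- The symbol of a vector-function (meaningful if its order is not `-1`). -/
def symbol {p : ℕ} {U : TopologicalSpace.Opens (Coord n m (Fin h) → ℝ)}
    (f : Fin p → SmoothFn U) : Matrix (Fin p) (Fin m) (MvPolynomial (Fin n) (SmoothFn U)) :=
  symbolAt (order f).toNat (tOrder f) f

/-! ### The adjoint linearized operator and the constant `O` -/

/-- The entry `L_{ij}` of the operator `L`, where `(-1)^h D̄_t^h - L` is the adjoint of the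
linearization of the system. The variable `u^i_{0,0}` is counted once, in the first sum. -/
def adjL {U : TopologicalSpace.Opens (Coord n m (Fin h) → ℝ)} (F : Fin m → SmoothFn U)
    (i j : Fin m) (ψ : SmoothFn U) : SmoothFn U :=
  (∑ᶠ I : Fin n →₀ ℕ, (-1) ^ I.degree * DxI I (pdu i 0 I (F j) * ψ)) +
    ∑ s ∈ Finset.Ico 1 h, (-1) ^ s * (DtBar F)^[s] (pdu i s 0 (F j) * ψ)

/-- Coefficients of an `m × m` matrix of operators `∑_I f_I^{ij} D̄_x^I + ∑_s g_s^{ij} D̄_t^s`. -/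
structure OpCoeffs (U : TopologicalSpace.Opens (Coord n m (Fin h) → ℝ)) where
  f : Fin m → Fin m → (Fin n →₀ ℕ) → SmoothFn U
  g : Fin m → Fin m → ℕ → SmoothFn U

/-- `L_{ij} = ∑_{|I| ≤ N} f_I^{ij} D̄_x^I + ∑_{1 ≤ s < h} g_s^{ij} D̄_t^s` as operators; the
coefficients outside of these ranges are zero. -/
def IsNormalForm {U : TopologicalSpace.Opens (Coord n m (Fin h) → ℝ)} (F : Fin m → SmoothFn U)
    (N : ℕ) (C : OpCoeffs U) : Prop :=
  (∀ i j I, N < I.degree → C.f i j I = 0) ∧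
  (∀ i j s, s ∉ Finset.Ico 1 h → C.g i j s = 0) ∧
  ∀ i j ψ, adjL F i j ψ =
    (∑ᶠ I : Fin n →₀ ℕ, C.f i j I * DxI I ψ) +
      ∑ s ∈ Finset.Ico 1 h, C.g i j s * (DtBar F)^[s] ψ

/-- `O = max {-1, o(f_I^{ij}) - N, o(g_s^{ij}) - N}`. -/
def constO {U : TopologicalSpace.Opens (Coord n m (Fin h) → ℝ)} (N : ℕ) (C : OpCoeffs U) : ℤ :=
  sSup ({-1} ∪ {r : ℤ | ∃ i j I, r = order ![C.f i j I] - N} ∪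
    {r : ℤ | ∃ i j s, r = order ![C.g i j s] - N})

/-! ### Conserved currents and characteristics -/

/-- `(J_0, J_1, …, J_n)` is a conserved current: `D̄_t J_0 + ∑ D̄_{x_i} J_i = 0`. -/
def IsConservedCurrent {U : TopologicalSpace.Opens (Coord n m (Fin h) → ℝ)}
    (F : Fin m → SmoothFn U) (J₀ : SmoothFn U) (J : Fin n → SmoothFn U) : Prop :=
  DtBar F J₀ + ∑ i, Dx i (J i) = 0

/-- The coordinates with `s < h` among all jet coordinates. -/
def Coord.incl : Coord n m (Fin h) → Coord n m ℕ
  | Coord.t => Coord.t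
  | Coord.x j => Coord.x j
  | Coord.u k s I => Coord.u k s.1 I

/-- The set of all jets whose coordinates with `s < h` form a point of `U`. -/
def fullJets (U : TopologicalSpace.Opens (Coord n m (Fin h) → ℝ)) :
    TopologicalSpace.Opens (Coord n m ℕ → ℝ) :=
  ⟨{θ | θ ∘ Coord.incl ∈ U},
    U.isOpen.preimage (continuous_pi fun c => continuous_apply (Coord.incl c))⟩

/-- A function of the coordinates with `s < h`, regarded as a function on the space of all jets. -/
def lift {U : TopologicalSpace.Opens (Coord n m (Fin h) → ℝ)} (f : SmoothFn U) :
    SmoothFn (fullJets U) :=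
  ⟨fun θ => f.1 ⟨θ.1 ∘ Coord.incl, θ.2⟩, by
    classical
    obtain ⟨S, g, hg, hf⟩ := f.2
    refine ⟨S.image Coord.incl,
      fun y => g fun i => y ⟨Coord.incl i.1, Finset.mem_image_of_mem _ i.2⟩, ?_, ?_⟩
    · refine hg.comp (contDiff_pi.2 fun i => contDiff_apply ℝ ℝ _).contDiffOn ?_
      rintro _ ⟨θ, hθ, rfl⟩
      exact ⟨θ ∘ Coord.incl, hθ, rfl⟩
    · intro θ
      exact hf _⟩

/-- The left-hand side `u^k_{h,0} - F^k` of the system, on the space of all jets. -/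
def eqn {U : TopologicalSpace.Opens (Coord n m (Fin h) → ℝ)} (F : Fin m → SmoothFn U)
    (k : Fin m) : SmoothFn (fullJets U) :=
  coordFn (Coord.u k h 0) - lift (F k)

/-- The ideal generated by the equations and all their differential consequences. A function on
the space of all jets equals, modulo this ideal, a unique function of the coordinates with
`s < h`. -/
def eqnIdeal {U : TopologicalSpace.Opens (Coord n m (Fin h) → ℝ)} (F : Fin m → SmoothFn U) :
    Ideal (SmoothFn (fullJets U)) :=
  Ideal.span {f | ∃ k s I, f = Dt^[s] (DxI I (eqn F k))}

/-- `χ` is the characteristic of the conservation law given by the conserved current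
`(J_0, J_1, …, J_n)`: for representatives `K` of the components of the current and a representation
`D_t K_0 + ∑ D_{x_i} K_i = ∑ g^k_{s,I} D_t^s D_x^I (u^k_{h,0} - F^k)` (finite sums) on the space of
all jets, `χ_k` is the class of `∑ (-1)^{s+|I|} D_t^s D_x^I (g^k_{s,I})`. -/
def IsCharacteristic {U : TopologicalSpace.Opens (Coord n m (Fin h) → ℝ)}
    (F : Fin m → SmoothFn U) (J₀ : SmoothFn U) (J : Fin n → SmoothFn U)
    (χ : Fin m → SmoothFn U) : Prop :=
  ∃ (K₀ : SmoothFn (fullJets U)) (K : Fin n → SmoothFn (fullJets U))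
    (g : Fin m → (ℕ × (Fin n →₀ ℕ)) →₀ SmoothFn (fullJets U)),
    K₀ - lift J₀ ∈ eqnIdeal F ∧
    (∀ i, K i - lift (J i) ∈ eqnIdeal F) ∧
    Dt K₀ + ∑ i, Dx i (K i) =
      ∑ k, (g k).sum (fun p c => c * Dt^[p.1] (DxI p.2 (eqn F k))) ∧
    ∀ k, (g k).sum (fun p c => (-1) ^ (p.1 + p.2.degree) * Dt^[p.1] (DxI p.2 c)) - lift (χ k)
      ∈ eqnIdeal F

end JetCons

end

open scoped ContDiff

noncomputable section

namespace JetCons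

/-! ### Calculus of smooth functions of finitely many coordinates. -/

section SmoothCalculus

section Calculus

variable {ι : Type} {U : TopologicalSpace.Opens (ι → ℝ)}

/-! A characteristic lies in the kernel of the adjoint linearization: $(-1)^h\bar D_t^h\chi=L\chi$
(`characteristic_equation`). On the space of all jets the Euler operators kill total divergences,
and integration by parts turns the given representation of the divergence into $E_k\bigl(\sum_l
G_l\,(u^l_{h,0}-F^l)\bigr)=0$, where $G_l$ restricts to $\chi_l$ on solutions. There the equations
vanish, so only the terms in which a derivative falls on an equation survive, and these add up to
the adjoint linearization applied to $\chi$.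

Let $a=\mathrm o(\chi)$, $b=\mathrm t(\chi)$. The symbol identity is the comparison of the
derivatives of both sides with respect to $u^j_{b,K}$, $|K|=a+N$. Because mixed derivatives do not
occur in $F$, the function $\bar D_t^pF$ with $p<h$ still has space order at most $N$, and its top
part is that of $F$, moved from time order $0$ to time order $p$ (`pdu_iterate_DtBar_rhs`). Hence
$\bar D_t^h$ raises the space order by at most $N$ and multiplies the symbol at time order $b$ by
$A$ from the right (`LexLE.sym_iterate_DtBar`), while $\bar D_t^s$ with $s<h$ contributes nothing
there. In $L$ only the $f_I$ with $|I|=N$ matter; they equal $(-1)^N\partial F^j/\partial u^i_{0,I}$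
and produce $(-1)^NA^t\mathbf S_\chi$. The assumption $\mathrm o(\chi)>O$ says precisely that all
coefficients of $L$ have order below $a+N$, so that they act as constants in this comparison
(`symbol_identity`).

The normal form of $L$ comes from the Leibniz rule, which also bounds the orders of the coefficients
by $2N$ and so gives $O\le N$ (`exists_isNormalForm`). Uniqueness is tested on monomials in $x$ and
powers of $t$ (`coeffs_eq_zero`). -/

@[ext]
theorem SmoothFn.ext {f g : SmoothFn U} (hfg : ∀ θ, f.1 θ = g.1 θ) : f = g :=
  Subtype.ext (funext hfg)

open Classical in
/-- The function `f` along the coordinate line through `θ` in the direction `c`. -/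
def slice (f : U → ℝ) (θ : U) (c : ι) : ℝ → ℝ := fun r =>
  if hr : Function.update θ.1 c r ∈ U then f ⟨Function.update θ.1 c r, hr⟩ else 0

theorem eventually_update_mem (θ : U) (c : ι) [DecidableEq ι] :
    ∀ᶠ r in nhds (θ.1 c), Function.update θ.1 c r ∈ U := by
  have hc : Continuous fun r : ℝ => Function.update θ.1 c r :=
    continuous_const.update c continuous_id
  have : ∀ᶠ r in nhds (θ.1 c), Function.update θ.1 c r ∈ (U : Set (ι → ℝ)) := by
    apply hc.continuousAt.eventually_mem
    rw [Function.update_eq_self]; exact U.isOpen.mem_nhds θ.2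
  exact this

theorem slice_self (f : U → ℝ) (θ : U) (c : ι) : slice f θ c (θ.1 c) = f θ := by
  simp [slice]

open Classical in
/-- The unit vector in the direction `c`, in the coordinates from `S`. -/
def dirVec (S : Finset ι) (c : ι) : S → ℝ := fun i => if i.1 = c then 1 else 0

theorem dirVec_eq_zero {S : Finset ι} {c : ι} (hc : c ∉ S) : dirVec S c = 0 := by
  funext i
  have : (i : ι) ≠ c := fun h => hc (h ▸ i.2)
  simp [dirVec, this]

open Classical in
theorem hasDerivAt_restrict_update (S : Finset ι) (θ : ι → ℝ) (c : ι) :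
    HasDerivAt (fun r : ℝ => S.restrict (Function.update θ c r))
      (dirVec S c) (θ c) := by
  rw [hasDerivAt_pi]
  rintro ⟨i, hi⟩
  by_cases hic : i = c
  · subst hic; simpa [dirVec] using hasDerivAt_id' (θ i)
  · simpa [hic, dirVec] using hasDerivAt_const (θ c) (θ i)

open Classical in
-- The value $0$ assigned outside `U` is harmless: near `θ` the coordinate line stays in the open
-- set `U`, where the slice agrees with the finite-dimensional representative `g`.
theorem hasDerivAt_slice_of_rep {f : U → ℝ} {S : Finset ι} {g : (S → ℝ) → ℝ}
    (hg : ContDiffOn ℝ ∞ g (S.restrict '' (U : Set (ι → ℝ))))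
    (hf : ∀ θ : U, f θ = g (S.restrict θ.1)) (θ : U) (c : ι) :
    HasDerivAt (slice f θ c) (fderiv ℝ g (S.restrict θ.1) (dirVec S c))
      (θ.1 c) := by
  have hd : HasFDerivAt g (fderiv ℝ g (S.restrict θ.1))
      (S.restrict (Function.update θ.1 c (θ.1 c))) := by
    rw [Function.update_eq_self]
    exact ((hg.contDiffAt ((isOpen_restrict_image U S).mem_nhds
      ⟨θ.1, θ.2, rfl⟩)).differentiableAt (by simp)).hasFDerivAt
  refine (hd.comp_hasDerivAt (θ.1 c) (hasDerivAt_restrict_update S θ.1 c)).congr_of_eventuallyEq ?_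
  filter_upwards [eventually_update_mem θ c] with r hr
  simp only [slice, hr, dite_true, hf, Function.comp]

theorem hasDerivAt_slice (f : SmoothFn U) (θ : U) (c : ι) :
    HasDerivAt (slice f.1 θ c) ((pd c f).1 θ) (θ.1 c) := by
  obtain ⟨S, g, hg, hf⟩ := f.2
  exact (hasDerivAt_slice_of_rep hg hf θ c).differentiableAt.hasDerivAt

theorem pd_eq_of_hasDerivAt {f : SmoothFn U} {θ : U} {c : ι} {d : ℝ}
    (hd : HasDerivAt (slice f.1 θ c) d (θ.1 c)) : (pd c f).1 θ = d :=
  (hasDerivAt_slice f θ c).unique hd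

open Classical in
theorem pd_apply_of_rep {f : SmoothFn U} {S : Finset ι} {g : (S → ℝ) → ℝ}
    (hg : ContDiffOn ℝ ∞ g (S.restrict '' (U : Set (ι → ℝ))))
    (hf : ∀ θ : U, f.1 θ = g (S.restrict θ.1)) (θ : U) (c : ι) :
    (pd c f).1 θ = fderiv ℝ g (S.restrict θ.1) (dirVec S c) :=
  pd_eq_of_hasDerivAt (hasDerivAt_slice_of_rep hg hf θ c)

theorem pd_add (c : ι) (f g : SmoothFn U) : pd c (f + g) = pd c f + pd c g := by
  ext θ
  refine pd_eq_of_hasDerivAt (((hasDerivAt_slice f θ c).add (hasDerivAt_slice g θ c)).congr_of_eventuallyEq ?_)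
  refine Filter.Eventually.of_forall fun r => ?_
  simp only [slice, Pi.add_apply]
  split_ifs <;> simp

theorem pd_mul (c : ι) (f g : SmoothFn U) : pd c (f * g) = f * pd c g + g * pd c f := by
  ext θ
  have h1 := (hasDerivAt_slice f θ c).mul (hasDerivAt_slice g θ c)
  rw [slice_self, slice_self] at h1
  have h2 : (pd c (f * g)).1 θ = _ := pd_eq_of_hasDerivAt (h1.congr_of_eventuallyEq ?_)
  · rw [h2]
    change _ = f.1 θ * (pd c g).1 θ + g.1 θ * (pd c f).1 θ
    ring
  refine Filter.Eventually.of_forall fun r => ?_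
  simp only [slice, Pi.mul_apply]
  split_ifs <;> simp

theorem pd_algebraMap (c : ι) (a : ℝ) : pd c (algebraMap ℝ (SmoothFn U) a) = 0 := by
  ext θ
  refine pd_eq_of_hasDerivAt ((hasDerivAt_const (θ.1 c) a).congr_of_eventuallyEq ?_)
  classical
  filter_upwards [eventually_update_mem θ c] with r hr
  have hr' : @Function.update ι (fun _ => ℝ) (fun a b => Classical.propDecidable (a = b)) θ.1 c r ∈ U := by
    convert hr
  simp only [slice, hr', dite_true]
  rfl

/-- `pd c` as a derivation. -/
def pdD (c : ι) : Derivation ℝ (SmoothFn U) (SmoothFn U) where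
  toFun := pd c
  map_add' := pd_add c
  map_smul' a f := by
    rw [Algebra.smul_def, pd_mul, pd_algebraMap]
    simp [Algebra.smul_def]
  map_one_eq_zero' := by
    have := pd_algebraMap (U := U) c 1
    simpa using this
  leibniz' f g := by
    simpa [smul_eq_mul] using pd_mul c f g

theorem pd_zero (c : ι) : pd c (0 : SmoothFn U) = 0 := (pdD c).map_zero

theorem pd_one (c : ι) : pd c (1 : SmoothFn U) = 0 := (pdD c).map_one_eq_zero

theorem pd_sub (c : ι) (f g : SmoothFn U) : pd c (f - g) = pd c f - pd c g := (pdD c).map_sub f g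

theorem pd_sum (c : ι) {α : Type*} (s : Finset α) (f : α → SmoothFn U) :
    pd c (∑ a ∈ s, f a) = ∑ a ∈ s, pd c (f a) := map_sum (pdD c) f s

theorem pd_coordFn [DecidableEq ι] (c c' : ι) :
    pd c (coordFn c' : SmoothFn U) = if c = c' then 1 else 0 := by
  classical
  ext θ
  have h1 := pd_apply_of_rep (f := (coordFn c' : SmoothFn U)) (S := {c'})
    (g := fun y => y ⟨c', Finset.mem_singleton_self c'⟩)
    (contDiff_apply ℝ ℝ _).contDiffOn (fun _ => rfl) θ c
  rw [h1]
  have : HasFDerivAt (fun y : (({c'} : Finset ι) → ℝ) => y ⟨c', Finset.mem_singleton_self c'⟩)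
    (ContinuousLinearMap.proj (R := ℝ) (φ := fun _ : ({c'} : Finset ι) => ℝ)
      ⟨c', Finset.mem_singleton_self c'⟩) (Finset.restrict {c'} θ.1) := hasFDerivAt_apply _ _
  rw [this.fderiv]
  split_ifs with hc
  · subst hc; simp [dirVec]
  · have : ¬ c' = c := fun e => hc e.symm
    simp [dirVec, this]

theorem contDiffOn_fderiv_apply {S : Finset ι} {g : (S → ℝ) → ℝ}
    (hg : ContDiffOn ℝ ∞ g (S.restrict '' (U : Set (ι → ℝ)))) (v : S → ℝ) :
    ContDiffOn ℝ ∞ (fun y => fderiv ℝ g y v) (S.restrict '' (U : Set (ι → ℝ))) :=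
  (hg.fderiv_of_isOpen (isOpen_restrict_image U S) (by simp)).clm_apply contDiffOn_const

theorem pd_comm (c c' : ι) (f : SmoothFn U) : pd c (pd c' f) = pd c' (pd c f) := by
  classical
  obtain ⟨S, g, hg, hf⟩ := f.2
  have key : ∀ (a b : ι) (θ : U), (pd a (pd b f)).1 θ =
      fderiv ℝ (fderiv ℝ g) (S.restrict θ.1) (dirVec S a)
        (dirVec S b) := by
    intro a b θ
    have hb : ∀ θ : U, (pd b f).1 θ =
        (fun y => fderiv ℝ g y (dirVec S b)) (S.restrict θ.1) :=
      fun θ => pd_apply_of_rep hg hf θ b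
    rw [pd_apply_of_rep (contDiffOn_fderiv_apply hg _) hb θ a]
    have hd : DifferentiableAt ℝ (fderiv ℝ g) (S.restrict θ.1) :=
      ((hg.fderiv_of_isOpen (isOpen_restrict_image U S) (m := ∞) (by simp)).contDiffAt
        ((isOpen_restrict_image U S).mem_nhds ⟨θ.1, θ.2, rfl⟩)).differentiableAt (by simp)
    rw [(hd.hasFDerivAt.clm_apply (hasFDerivAt_const _ _)).fderiv]
    simp
  ext θ
  rw [key, key]
  have hs : IsSymmSndFDerivAt ℝ g (S.restrict θ.1) :=
    (hg.contDiffAt ((isOpen_restrict_image U S).mem_nhds ⟨θ.1, θ.2, rfl⟩)).isSymmSndFDerivAt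
      (by simpa using (WithTop.coe_le_coe.2 le_top : ((2 : ℕ∞) : WithTop ℕ∞) ≤ ∞))
  exact hs _ _

theorem finite_pd_ne_zero (f : SmoothFn U) : {c | pd c f ≠ 0}.Finite := by
  classical
  obtain ⟨S, g, hg, hf⟩ := f.2
  refine S.finite_toSet.subset fun c hc => ?_
  by_contra hcS
  refine hc (SmoothFn.ext fun θ => ?_)
  rw [pd_apply_of_rep hg hf θ c, dirVec_eq_zero hcS, map_zero]; rfl

/-- The coordinates on which `f` depends infinitesimally. -/
def supp (f : SmoothFn U) : Finset ι := (finite_pd_ne_zero f).toFinset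

theorem mem_supp {f : SmoothFn U} {c : ι} : c ∈ supp f ↔ pd c f ≠ 0 := by simp [supp]

theorem pd_eq_zero_of_notMem_supp {f : SmoothFn U} {c : ι} (hc : c ∉ supp f) : pd c f = 0 := by
  simpa [mem_supp] using hc

/-- Any finite set containing the support may be used, so that sums belonging to different functions
can be put over one index set and compared term by term. -/
theorem vf_eq_sum (w : ι → SmoothFn U) (f : SmoothFn U) {T : Finset ι} (hT : supp f ⊆ T) :
    vf w f = ∑ c ∈ T, w c * pd c f := by
  refine finsum_eq_sum_of_support_subset _ fun c hc => hT (mem_supp.2 fun h0 => hc ?_)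
  simp [h0]

theorem vf_add (w : ι → SmoothFn U) (f g : SmoothFn U) : vf w (f + g) = vf w f + vf w g := by
  classical
  rw [vf_eq_sum w (f + g) (T := supp (f + g) ∪ supp f ∪ supp g) (by grind),
    vf_eq_sum w f (T := supp (f + g) ∪ supp f ∪ supp g) (by grind),
    vf_eq_sum w g (T := supp (f + g) ∪ supp f ∪ supp g) (by grind), ← Finset.sum_add_distrib]
  exact Finset.sum_congr rfl fun c _ => by rw [pd_add, mul_add]

theorem vf_mul (w : ι → SmoothFn U) (f g : SmoothFn U) :
    vf w (f * g) = f * vf w g + g * vf w f := by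
  classical
  rw [vf_eq_sum w (f * g) (T := supp (f * g) ∪ supp f ∪ supp g) (by grind),
    vf_eq_sum w f (T := supp (f * g) ∪ supp f ∪ supp g) (by grind),
    vf_eq_sum w g (T := supp (f * g) ∪ supp f ∪ supp g) (by grind),
    Finset.mul_sum, Finset.mul_sum, ← Finset.sum_add_distrib]
  exact Finset.sum_congr rfl fun c _ => by rw [pd_mul]; ring

theorem vf_algebraMap (w : ι → SmoothFn U) (a : ℝ) : vf w (algebraMap ℝ (SmoothFn U) a) = 0 := by
  simp only [vf, pd_algebraMap, mul_zero, finsum_zero]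

/-- `vf w` as a derivation. -/
def vfD (w : ι → SmoothFn U) : Derivation ℝ (SmoothFn U) (SmoothFn U) where
  toFun := vf w
  map_add' := vf_add w
  map_smul' a f := by
    rw [Algebra.smul_def, vf_mul, vf_algebraMap]
    simp [Algebra.smul_def]
  map_one_eq_zero' := by simpa using vf_algebraMap w 1
  leibniz' f g := by simpa [smul_eq_mul] using vf_mul w f g

theorem vfD_apply (w : ι → SmoothFn U) (f : SmoothFn U) : vfD w f = vf w f := rfl

theorem vf_coordFn (w : ι → SmoothFn U) (c : ι) : vf w (coordFn c) = w c := by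
  classical
  rw [vf, finsum_eq_single _ c]
  · simp [pd_coordFn]
  · intro c' hc'; simp [pd_coordFn, hc']

/-- A linear relation between differentials is a relation between the derivatives along any
vector field. -/
theorem vf_eq_of_pd_eq {α : Type*} {A : Finset α} {g : SmoothFn U} {L G : α → SmoothFn U}
    (hg : ∀ c, pd c g = ∑ a ∈ A, L a * pd c (G a)) (w : ι → SmoothFn U) :
    vf w g = ∑ a ∈ A, L a * vf w (G a) := by
  classical
  have hT : ∀ a ∈ A, supp (G a) ⊆ supp g ∪ A.biUnion fun a => supp (G a) := fun a ha =>
    (Finset.subset_biUnion_of_mem (fun a => supp (G a)) ha).trans Finset.subset_union_right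
  rw [vf_eq_sum w g (T := supp g ∪ A.biUnion fun a => supp (G a)) Finset.subset_union_left,
    Finset.sum_congr (s₁ := A) rfl fun a ha => by
      rw [vf_eq_sum w (G a) (hT a ha), Finset.mul_sum], Finset.sum_comm]
  refine Finset.sum_congr rfl fun c _ => ?_
  rw [hg, Finset.mul_sum]
  exact Finset.sum_congr rfl fun a _ => by ring

/-- The commutator of $\partial_c$ with a vector field is the field whose coefficients are
differentiated by $\partial_c$. -/
theorem pd_vf (c : ι) (w : ι → SmoothFn U) (f : SmoothFn U) :
    pd c (vf w f) = vf w (pd c f) + vf (fun c' => pd c (w c')) f := by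
  classical
  rw [vf_eq_sum w f (T := supp f ∪ supp (pd c f)) (by grind),
    vf_eq_sum w (pd c f) (T := supp f ∪ supp (pd c f)) (by grind),
    vf_eq_sum _ f (T := supp f ∪ supp (pd c f)) (by grind), pd_sum, ← Finset.sum_add_distrib]
  refine Finset.sum_congr rfl fun c' _ => ?_
  rw [pd_mul, pd_comm c c']; ring

/-- The commutator of two fields is again of first order, since the second order terms are
symmetric; so it vanishes once it vanishes on the coordinates. -/
theorem vf_comm {w v : ι → SmoothFn U} (hwv : ∀ c, vf w (v c) = vf v (w c)) (f : SmoothFn U) :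
    vf w (vf v f) = vf v (vf w f) := by
  classical
  have key : ∀ (a b : ι → SmoothFn U), vf a (vf b f) =
      ∑ c ∈ supp f, vf a (b c) * pd c f + ∑ c ∈ supp f, ∑ c' ∈ supp f ∪ (supp f).biUnion
        (fun c => supp (pd c f)), b c * a c' * pd c (pd c' f) := by
    intro a b
    rw [vf_eq_sum b f (T := supp f) subset_rfl, ← vfD_apply, map_sum (vfD a),
      ← Finset.sum_add_distrib]
    refine Finset.sum_congr rfl fun c hc => ?_
    rw [Derivation.leibniz, vfD_apply, vfD_apply, smul_eq_mul, smul_eq_mul, vf_eq_sum a (pd c f)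
      ((Finset.subset_biUnion_of_mem (fun c => supp (pd c f)) hc).trans
        (Finset.subset_union_right (s₁ := supp f))), Finset.mul_sum, add_comm]
    congr 1
    · ring
    · exact Finset.sum_congr rfl fun c' _ => by rw [pd_comm c c']; ring
  -- Cutting the inner sum down to `supp f` gives both indices the same range, so that the second
  -- order part can be transposed.
  have trim : ∀ (a b : ι → SmoothFn U) c, ∑ c' ∈ supp f ∪ (supp f).biUnion
        (fun c => supp (pd c f)), b c * a c' * pd c (pd c' f) =
        ∑ c' ∈ supp f, b c * a c' * pd c (pd c' f) := by
    intro a b c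
    refine (Finset.sum_subset Finset.subset_union_left fun c' _ hc' => ?_).symm
    rw [pd_eq_zero_of_notMem_supp hc', pd_zero, mul_zero]
  rw [key, key]
  simp only [trim, hwv]
  congr 1
  rw [Finset.sum_comm]
  exact Finset.sum_congr rfl fun c _ => Finset.sum_congr rfl fun c' _ => by
    rw [pd_comm c c']; ring

end Calculus

/-! ### Substitution and the chain rule. -/

section Subst

variable {ι κ : Type} {U : TopologicalSpace.Opens (ι → ℝ)} {V : TopologicalSpace.Opens (κ → ℝ)}

open Classical in
theorem subst_mem (φ : κ → SmoothFn U) (hφ : ∀ θ : U, (fun c => (φ c).1 θ) ∈ V) (f : SmoothFn V) :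
    (fun θ : U => f.1 ⟨fun c => (φ c).1 θ, hφ θ⟩) ∈ SmoothFn U := by
  obtain ⟨S, g, hg, hf⟩ := f.2
  choose T G hG hφG using fun c => (φ c).2
  refine ⟨S.biUnion T, fun y => g fun c => G c.1 (Finset.restrict₂ (π := fun _ => ℝ)
    (Finset.subset_biUnion_of_mem T c.2) y), ?_, fun θ => ?_⟩
  · refine hg.comp (contDiffOn_pi.2 fun c => (hG c.1).comp
      (contDiff_pi.2 fun i => contDiff_apply ℝ ℝ _).contDiffOn ?_) ?_
    · rintro _ ⟨θ, hθ, rfl⟩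
      exact ⟨θ, hθ, rfl⟩
    · rintro _ ⟨θ, hθ, rfl⟩
      refine ⟨fun c => (φ c).1 ⟨θ, hθ⟩, hφ ⟨θ, hθ⟩, ?_⟩
      funext c
      exact hφG c.1 ⟨θ, hθ⟩
  · refine (hf _).trans ?_
    congr 1
    funext c
    exact hφG c.1 θ

/-- Substitution of smooth functions for the coordinates. -/
def subst (φ : κ → SmoothFn U) (hφ : ∀ θ : U, (fun c => (φ c).1 θ) ∈ V) :
    SmoothFn V →ₐ[ℝ] SmoothFn U where
  toFun f := ⟨fun θ : U => f.1 ⟨fun c => (φ c).1 θ, hφ θ⟩, subst_mem φ hφ f⟩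
  map_one' := rfl
  map_mul' _ _ := rfl
  map_zero' := rfl
  map_add' _ _ := rfl
  commutes' _ := rfl

theorem subst_apply (φ : κ → SmoothFn U) (hφ : ∀ θ : U, (fun c => (φ c).1 θ) ∈ V)
    (f : SmoothFn V) (θ : U) : (subst φ hφ f).1 θ = f.1 ⟨fun c => (φ c).1 θ, hφ θ⟩ := rfl

/-- Only the finitely many coordinates in `S` enter `f`, so this is the finite-dimensional chain
rule along the curve formed by the slices of the functions `φ c`. -/
theorem pd_subst (φ : κ → SmoothFn U) (hφ : ∀ θ : U, (fun c => (φ c).1 θ) ∈ V) (f : SmoothFn V)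
    (c : ι) : pd c (subst φ hφ f) = ∑ c' ∈ supp f, subst φ hφ (pd c' f) * pd c (φ c') := by
  classical
  obtain ⟨S, g, hg, hf⟩ := f.2
  have hsum : ∑ c' ∈ supp f, subst φ hφ (pd c' f) * pd c (φ c') =
      ∑ c' ∈ S, subst φ hφ (pd c' f) * pd c (φ c') := by
    refine Finset.sum_subset_zero_on_sdiff (fun c' hc' => ?_) (fun c' hc' => ?_) fun _ _ => rfl
    · by_contra hS
      refine mem_supp.1 hc' (SmoothFn.ext fun θ => ?_)
      rw [pd_apply_of_rep hg hf θ c', dirVec_eq_zero hS, map_zero]; rfl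
    · rw [pd_eq_zero_of_notMem_supp (Finset.mem_sdiff.1 hc').2, map_zero, zero_mul]
  rw [hsum]
  ext θ
  set θ' : V := ⟨fun c => (φ c).1 θ, hφ θ⟩ with hθ'
  have hd : HasFDerivAt g (fderiv ℝ g (S.restrict θ'.1)) (S.restrict θ'.1) :=
    ((hg.contDiffAt ((isOpen_restrict_image V S).mem_nhds
      ⟨θ'.1, θ'.2, rfl⟩)).differentiableAt (by simp)).hasFDerivAt
  have hin : HasDerivAt (fun r => fun c' : S => slice (φ c'.1).1 θ c r)
      (fun c' : S => (pd c (φ c'.1)).1 θ) (θ.1 c) :=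
    hasDerivAt_pi.2 fun c' => hasDerivAt_slice _ _ _
  have hpt : (fun c' : S => slice (φ c'.1).1 θ c (θ.1 c)) = S.restrict θ'.1 := by
    funext c'; rw [slice_self]; rfl
  have hcomp := (hpt ▸ hd : HasFDerivAt g (fderiv ℝ g (S.restrict θ'.1))
    (fun c' : S => slice (φ c'.1).1 θ c (θ.1 c))).comp_hasDerivAt (θ.1 c) hin
  have hval : (pd c (subst φ hφ f)).1 θ = _ :=
    pd_eq_of_hasDerivAt (hcomp.congr_of_eventuallyEq ?_)
  · rw [hval]
    have hvec : (fun c' : S => (pd c (φ c'.1)).1 θ) =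
        ∑ c' : S, (pd c (φ c'.1)).1 θ • dirVec S c'.1 := by
      funext i
      simp [Finset.sum_apply, dirVec]
    rw [hvec, map_sum]
    rw [show (∑ c' ∈ S, subst φ hφ (pd c' f) * pd c (φ c')).1 θ =
      ∑ c' ∈ S, (subst φ hφ (pd c' f)).1 θ * (pd c (φ c')).1 θ by
        rw [AddSubmonoidClass.coe_finsetSum, Finset.sum_apply]; rfl]
    rw [← Finset.sum_coe_sort S]
    refine Finset.sum_congr rfl fun c' _ => ?_
    rw [map_smul, smul_eq_mul, mul_comm, subst_apply, ← pd_apply_of_rep hg hf θ' c'.1]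
  · filter_upwards [eventually_update_mem θ c] with r hr
    have hr' : @Function.update ι (fun _ => ℝ) (fun a b => Classical.propDecidable (a = b))
      θ.1 c r ∈ U := by convert hr
    simp only [slice, hr', dite_true, Function.comp]
    rw [subst_apply, hf]
    rfl

/-- By the chain rule, two fields are related by a substitution as soon as they are related on the
coordinates. This is how restriction to solutions is shown to intertwine the total derivatives. -/
theorem vf_subst (φ : κ → SmoothFn U) (hφ : ∀ θ : U, (fun c => (φ c).1 θ) ∈ V)
    {w : ι → SmoothFn U} {v : κ → SmoothFn V} (hwv : ∀ c, vf w (φ c) = subst φ hφ (v c))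
    (f : SmoothFn V) : vf w (subst φ hφ f) = subst φ hφ (vf v f) := by
  rw [vf_eq_of_pd_eq (pd_subst φ hφ f) w, vf_eq_sum v f subset_rfl, map_sum]
  exact Finset.sum_congr rfl fun c _ => by rw [map_mul, hwv, mul_comm]

end Subst

end SmoothCalculus

/-! ### Total derivatives and their commutation rules. -/

section TotalDerivatives

/-- The iterates of an additive map. -/
def iterHom {A : Type*} [AddCommMonoid A] (D : A →+ A) (s : ℕ) : A →+ A where
  toFun := D^[s]
  map_zero' := iterate_map_zero D s
  map_add' := iterate_map_add D s

theorem multiIndex_induction {α : Type*} {P : (α →₀ ℕ) → Prop} (h0 : P 0)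
    (hs : ∀ I j, P I → P (I + Finsupp.single j 1)) (I : α →₀ ℕ) : P I := by
  suffices H : ∀ K I, P I → P (I + K) by simpa using H I 0 h0
  intro K
  induction K using Finsupp.induction_linear with
  | zero => intro I hI; simpa using hI
  | add f g hf hg => intro I hI; rw [← add_assoc]; exact hg _ (hf _ hI)
  | single a b =>
    induction b with
    | zero => intro I hI; simpa using hI
    | succ b ih => intro I hI; rw [Finsupp.single_add, ← add_assoc]; exact hs _ _ (ih _ hI)

section VF

variable {ι : Type} {U : TopologicalSpace.Opens (ι → ℝ)}

theorem vf_zero_left (f : SmoothFn U) : vf (fun _ => 0) f = 0 := by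
  simp only [vf, zero_mul, finsum_zero]

theorem vf_zero (w : ι → SmoothFn U) : vf w 0 = 0 := (vfD w).map_zero

theorem vf_one (w : ι → SmoothFn U) : vf w 1 = 0 := (vfD w).map_one_eq_zero

open Classical in
theorem vf_indicator (c : ι) (f : SmoothFn U) :
    vf (fun c' => if c' = c then 1 else 0) f = pd c f := by
  rw [vf, finsum_eq_single _ c]
  · simp
  · intro c' hc'; simp [hc']

end VF

variable {n m h : ℕ}

section Dx

variable {σ : Type} {U : TopologicalSpace.Opens (Coord n m σ → ℝ)}

/-- The components of the vector field `Dx j`. -/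
def dxW (j : Fin n) : Coord n m σ → SmoothFn U
  | Coord.t => 0
  | Coord.x i => if i = j then 1 else 0
  | Coord.u k s I => coordFn (Coord.u k s (I + Finsupp.single j 1))

theorem Dx_eq_vf (j : Fin n) : (Dx j : SmoothFn U → SmoothFn U) = vf (dxW j) := by
  unfold Dx
  congr 1

/-- `Dx j` as a derivation. -/
def dxD (j : Fin n) : Derivation ℝ (SmoothFn U) (SmoothFn U) := vfD (dxW j)

theorem dxD_apply (j : Fin n) (f : SmoothFn U) : dxD j f = Dx j f := by
  rw [Dx_eq_vf]; rfl

theorem Dx_zero (j : Fin n) : Dx j (0 : SmoothFn U) = 0 := by rw [← dxD_apply, map_zero]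

theorem Dx_add (j : Fin n) (f g : SmoothFn U) : Dx j (f + g) = Dx j f + Dx j g := by
  simp only [← dxD_apply, map_add]

theorem Dx_mul (j : Fin n) (f g : SmoothFn U) : Dx j (f * g) = f * Dx j g + g * Dx j f := by
  simp only [← dxD_apply, Derivation.leibniz, smul_eq_mul]

theorem Dx_coordFn (j : Fin n) (c : Coord n m σ) : Dx j (coordFn c : SmoothFn U) = dxW j c := by
  rw [Dx_eq_vf, vf_coordFn]

theorem Dx_comm (i j : Fin n) (f : SmoothFn U) : Dx i (Dx j f) = Dx j (Dx i f) := by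
  rw [Dx_eq_vf, Dx_eq_vf]
  refine vf_comm (fun c => ?_) f
  cases c with
  | t => simp only [dxW, vf_zero]
  | x l => simp only [dxW]; split_ifs <;> simp only [vf_zero, vf_one]
  | u k s I => simp only [dxW, vf_coordFn]; rw [add_right_comm]

/-- `DxI` is a product in a fixed order. The new factor is moved to the front by commutativity, and
`Nodup` guarantees that it occurs only once; a general list is needed for the induction. -/
theorem foldr_Dx_add_single (I : Fin n →₀ ℕ) (i : Fin n) (f : SmoothFn U) (l : List (Fin n))
    (hl : l.Nodup) :
    l.foldr (fun j g => (Dx j)^[(I + Finsupp.single i 1 : Fin n →₀ ℕ) j] g) f =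
      if i ∈ l then Dx i (l.foldr (fun j g => (Dx j)^[I j] g) f)
      else l.foldr (fun j g => (Dx j)^[I j] g) f := by
  induction l with
  | nil => simp
  | cons a l ih =>
    rw [List.nodup_cons] at hl
    rw [List.foldr_cons, List.foldr_cons, ih hl.2]
    by_cases ha : i = a
    · subst ha
      simp only [hl.1, if_false, List.mem_cons, true_or, if_true, Finsupp.add_apply,
        Finsupp.single_eq_same, Function.iterate_succ_apply']
    · have h1 : (I + Finsupp.single i 1 : Fin n →₀ ℕ) a = I a := by
        simp [ha]
      rw [h1]
      by_cases hil : i ∈ l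
      · simp only [hil, if_true, List.mem_cons, or_true]
        have hc : Function.Commute (Dx a : SmoothFn U → SmoothFn U) (Dx i) := Dx_comm a i
        exact (hc.iterate_left (I a)) _
      · simp only [hil, if_false, List.mem_cons, ha, or_self]

theorem DxI_zero_index (f : SmoothFn U) : DxI 0 f = f := by
  unfold DxI
  generalize List.finRange n = l
  induction l with
  | nil => rfl
  | cons a l ih => rw [List.foldr_cons, ih]; rfl

theorem DxI_add_single (I : Fin n →₀ ℕ) (i : Fin n) (f : SmoothFn U) :
    DxI (I + Finsupp.single i 1) f = Dx i (DxI I f) := by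
  unfold DxI
  rw [foldr_Dx_add_single I i f _ (List.nodup_finRange n), if_pos (List.mem_finRange i)]

/-- `DxI I` as an additive map. -/
def dxIHom (I : Fin n →₀ ℕ) : SmoothFn U →+ SmoothFn U where
  toFun := DxI I
  map_zero' := by
    induction I using multiIndex_induction with
    | h0 => exact DxI_zero_index 0
    | hs I j ih => rw [DxI_add_single, ih, Dx_zero]
  map_add' f g := by
    induction I using multiIndex_induction with
    | h0 => simp only [DxI_zero_index]
    | hs I j ih => rw [DxI_add_single, ih, Dx_add, DxI_add_single, DxI_add_single]

theorem DxI_zero (I : Fin n →₀ ℕ) : DxI I (0 : SmoothFn U) = 0 := (dxIHom I).map_zero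

theorem DxI_comm_of_Dx_comm (I : Fin n →₀ ℕ) {P : SmoothFn U → SmoothFn U}
    (hP : ∀ j f, P (Dx j f) = Dx j (P f)) (f : SmoothFn U) : P (DxI I f) = DxI I (P f) := by
  induction I using multiIndex_induction with
  | h0 => simp only [DxI_zero_index]
  | hs I j ih => rw [DxI_add_single, hP, ih, DxI_add_single]

theorem DxI_Dx (I : Fin n →₀ ℕ) (j : Fin n) (f : SmoothFn U) : DxI I (Dx j f) = Dx j (DxI I f) :=
  (DxI_comm_of_Dx_comm I (Dx_comm j) f).symm

/-- $[\partial/\partial u_{K+1_j},D_{x_j}]=\partial/\partial u_K$. Together with the case $K_j=0$,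
where the commutator vanishes, it governs all order and symbol computations for space derivatives.
-/
theorem pd_Dx_add_single (j : Fin n) (k : Fin m) (s : σ) (K : Fin n →₀ ℕ) (f : SmoothFn U) :
    pd (Coord.u k s (K + Finsupp.single j 1)) (Dx j f) =
      Dx j (pd (Coord.u k s (K + Finsupp.single j 1)) f) + pd (Coord.u k s K) f := by
  classical
  rw [Dx_eq_vf, pd_vf, ← vf_indicator (Coord.u k s K) f]
  congr 2
  funext c
  cases c with
  | t => simp [dxW, pd_zero]
  | x i => simp only [dxW]; split_ifs <;> simp_all [pd_zero, pd_one]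
  | u k' s' I =>
    simp only [dxW, pd_coordFn, Coord.u.injEq, add_left_inj]
    congr 1
    simp only [eq_iff_iff]
    constructor <;> rintro ⟨rfl, rfl, rfl⟩ <;> simp

theorem pd_Dx_of_eq_zero (j : Fin n) (k : Fin m) (s : σ) (K : Fin n →₀ ℕ) (hK : K j = 0)
    (f : SmoothFn U) : pd (Coord.u k s K) (Dx j f) = Dx j (pd (Coord.u k s K) f) := by
  classical
  rw [Dx_eq_vf, pd_vf, add_eq_left]
  convert vf_zero_left f using 2
  funext c
  cases c with
  | t => simp [dxW, pd_zero]
  | x i => simp only [dxW]; split_ifs <;> simp_all [pd_zero, pd_one]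
  | u k' s' I =>
    simp only [dxW, pd_coordFn, Coord.u.injEq]
    rw [if_neg]
    rintro ⟨-, -, rfl⟩
    simp at hK

end Dx

section Dt

variable {U : TopologicalSpace.Opens (Coord n m ℕ → ℝ)}

/-- The components of the vector field `Dt`. -/
def dtW : Coord n m ℕ → SmoothFn U
  | Coord.t => 1
  | Coord.x _ => 0
  | Coord.u k s I => coordFn (Coord.u k (s + 1) I)

theorem Dt_eq_vf : (Dt : SmoothFn U → SmoothFn U) = vf dtW := by
  unfold Dt
  congr 1

/-- `Dt` as a derivation. -/
def dtD : Derivation ℝ (SmoothFn U) (SmoothFn U) := vfD dtW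

theorem dtD_apply (f : SmoothFn U) : dtD f = Dt f := by rw [Dt_eq_vf]; rfl

theorem Dt_mul (f g : SmoothFn U) : Dt (f * g) = f * Dt g + g * Dt f := by
  simp only [← dtD_apply, Derivation.leibniz, smul_eq_mul]

theorem Dt_Dx_comm (j : Fin n) (f : SmoothFn U) : Dt (Dx j f) = Dx j (Dt f) := by
  rw [Dt_eq_vf, Dx_eq_vf]
  refine vf_comm (fun c => ?_) f
  cases c with
  | t => simp only [dxW, dtW, vf_zero, vf_one]
  | x l => simp only [dxW, dtW]; split_ifs <;> simp only [vf_zero, vf_one]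
  | u k s I => simp only [dxW, dtW, vf_coordFn]

theorem pd_Dt_succ (k : Fin m) (s : ℕ) (K : Fin n →₀ ℕ) (f : SmoothFn U) :
    pd (Coord.u k (s + 1) K) (Dt f) =
      Dt (pd (Coord.u k (s + 1) K) f) + pd (Coord.u k s K) f := by
  classical
  rw [Dt_eq_vf, pd_vf, ← vf_indicator (Coord.u k s K) f]
  congr 2
  funext c
  cases c with
  | t => simp [dtW, pd_one]
  | x i => simp [dtW, pd_zero]
  | u k' s' I =>
    simp only [dtW, pd_coordFn, Coord.u.injEq, add_left_inj]
    congr 1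
    simp only [eq_iff_iff]
    constructor <;> rintro ⟨rfl, rfl, rfl⟩ <;> simp

theorem pd_Dt_zero (k : Fin m) (K : Fin n →₀ ℕ) (f : SmoothFn U) :
    pd (Coord.u k 0 K) (Dt f) = Dt (pd (Coord.u k 0 K) f) := by
  classical
  rw [Dt_eq_vf, pd_vf, add_eq_left]
  convert vf_zero_left f using 2
  funext c
  cases c with
  | t => simp [dtW, pd_one]
  | x i => simp [dtW, pd_zero]
  | u k' s' I => simp [dtW, pd_coordFn]

end Dt

section DtBar

variable {U : TopologicalSpace.Opens (Coord n m (Fin h) → ℝ)} (F : Fin m → SmoothFn U)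

/-- The components of the vector field `DtBar F`. -/
def dtbW : Coord n m (Fin h) → SmoothFn U
  | Coord.t => 1
  | Coord.x _ => 0
  | Coord.u k s I =>
      if hs : s.1 + 1 < h then coordFn (Coord.u k ⟨s.1 + 1, hs⟩ I) else DxI I (F k)

theorem DtBar_eq_vf : DtBar F = vf (dtbW F) := by
  unfold DtBar
  congr 1

/-- `DtBar F` as a derivation. -/
def dtbD : Derivation ℝ (SmoothFn U) (SmoothFn U) := vfD (dtbW F)

theorem dtbD_apply (f : SmoothFn U) : dtbD F f = DtBar F f := by rw [DtBar_eq_vf]; rfl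

theorem coe_dtbD : ⇑(dtbD F) = DtBar F := funext (dtbD_apply F)

theorem DtBar_coordFn (c : Coord n m (Fin h)) : DtBar F (coordFn c) = dtbW F c := by
  rw [DtBar_eq_vf, vf_coordFn]

theorem DtBar_Dx_comm (j : Fin n) (f : SmoothFn U) :
    DtBar F (Dx j f) = Dx j (DtBar F f) := by
  have key : vf (dtbW F) (vf (dxW j) f) = vf (dxW j) (vf (dtbW F) f) := by
    refine vf_comm (fun c => ?_) f
    cases c with
    | t => simp only [dxW, dtbW, vf_zero, vf_one]
    | x l => simp only [dxW, dtbW]; split_ifs <;> simp only [vf_zero, vf_one]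
    | u k s I =>
      simp only [dxW, dtbW, vf_coordFn]
      split_ifs with hs
      · simp only [vf_coordFn, dxW]
      -- At $s=h-1$ the coefficients are $\bar D_x^IF^k$, and compatibility means $\bar
      -- D_x^{I+1_j}F^k=\bar D_{x_j}\bar D_x^IF^k$.
      · rw [DxI_add_single, Dx_eq_vf]
  rw [DtBar_eq_vf, Dx_eq_vf, key]

theorem DtBar_DxI_comm (I : Fin n →₀ ℕ) (f : SmoothFn U) :
    DtBar F (DxI I f) = DxI I (DtBar F f) :=
  DxI_comm_of_Dx_comm I (DtBar_Dx_comm F) f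

/-- The iterates of `DtBar F` as additive maps. -/
def dtbPow (s : ℕ) : SmoothFn U →+ SmoothFn U := iterHom (dtbD F : SmoothFn U →+ SmoothFn U) s

theorem dtbPow_apply (s : ℕ) (f : SmoothFn U) : dtbPow F s f = (DtBar F)^[s] f := by
  rw [← coe_dtbD]; rfl

end DtBar

end TotalDerivatives

section Characteristics

variable {n m h : ℕ}

/-! ### Euler operators on the space of all jets. -/

section Euler

variable {V : TopologicalSpace.Opens (Coord n m ℕ → ℝ)}

/-- The derivatives of `f` with respect to all derivatives of `u^k`. -/
def jetGrad (k : Fin m) (f : SmoothFn V) : (ℕ × (Fin n →₀ ℕ)) →₀ SmoothFn V :=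
  Finsupp.ofSupportFinite (fun p => pd (Coord.u k p.1 p.2) f) <| by
    refine Set.Finite.preimage (f := fun p : ℕ × (Fin n →₀ ℕ) => Coord.u k p.1 p.2) ?_
      (finite_pd_ne_zero f)
    rintro ⟨s, I⟩ - ⟨s', I'⟩ - hp
    simpa using hp

theorem jetGrad_apply (k : Fin m) (f : SmoothFn V) (p : ℕ × (Fin n →₀ ℕ)) :
    jetGrad k f p = pd (Coord.u k p.1 p.2) f := rfl

/-- The operator `(-1)^{s+|I|} D_t^s D_x^I`. -/
def jetAdj (p : ℕ × (Fin n →₀ ℕ)) : SmoothFn V →+ SmoothFn V :=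
  (AddMonoidHom.mulLeft ((-1) ^ (p.1 + p.2.degree))).comp
    ((iterHom ((dtD (U := V) : SmoothFn V →ₗ[ℝ] SmoothFn V) : SmoothFn V →+ SmoothFn V) p.1).comp (dxIHom p.2))

theorem jetAdj_apply (p : ℕ × (Fin n →₀ ℕ)) (f : SmoothFn V) :
    jetAdj p f = (-1) ^ (p.1 + p.2.degree) * Dt^[p.1] (DxI p.2 f) := by
  rw [show (Dt : SmoothFn V → SmoothFn V) = ⇑(dtD (U := V)) from funext fun f => (dtD_apply f).symm]
  rfl

theorem jetAdj_add_single (s : ℕ) (I : Fin n →₀ ℕ) (j : Fin n) (f : SmoothFn V) :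
    jetAdj (s, I + Finsupp.single j 1) f = -jetAdj (s, I) (Dx j f) := by
  rw [jetAdj_apply, jetAdj_apply, DxI_add_single, DxI_Dx, map_add, Finsupp.degree_single,
    ← add_assoc, pow_succ]
  ring

theorem jetAdj_succ (s : ℕ) (I : Fin n →₀ ℕ) (f : SmoothFn V) :
    jetAdj (s + 1, I) f = -jetAdj (s, I) (Dt f) := by
  rw [jetAdj_apply, jetAdj_apply]
  simp only
  rw [Function.iterate_succ_apply, DxI_comm_of_Dx_comm I Dt_Dx_comm, add_right_comm, pow_succ]
  ring

/-- The two summands, a differentiated gradient and a shifted one, cancel under `jetAdj` because the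
shift changes the sign; hence total derivatives lie in the kernel of `euler`. -/
theorem jetGrad_Dx (k : Fin m) (j : Fin n) (f : SmoothFn V) :
    jetGrad k (Dx j f) = (jetGrad k f).mapRange (Dx j) (Dx_zero j) +
      (jetGrad k f).mapDomain fun p => (p.1, p.2 + Finsupp.single j 1) := by
  have hinj : Function.Injective
      fun p : ℕ × (Fin n →₀ ℕ) => (p.1, p.2 + Finsupp.single j 1) := by
    rintro ⟨s, I⟩ ⟨s', I'⟩ hp
    simpa using hp
  ext1 ⟨s, K⟩
  rw [Finsupp.add_apply, Finsupp.mapRange_apply, jetGrad_apply, jetGrad_apply]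
  by_cases hK : K j = 0
  · rw [Finsupp.mapDomain_of_notMem_range, add_zero, pd_Dx_of_eq_zero _ _ _ _ hK]
    rintro ⟨⟨s', I⟩, hp⟩
    simp only [Prod.mk.injEq] at hp
    rw [← hp.2] at hK
    simp at hK
  · obtain ⟨I, rfl⟩ : ∃ I, K = I + Finsupp.single j 1 :=
      ⟨K - Finsupp.single j 1, (tsub_add_cancel_of_le (by
        rw [Finsupp.single_le_iff]; omega)).symm⟩
    have := Finsupp.mapDomain_apply hinj (jetGrad k f) (s, I)
    simp only at this
    rw [this, jetGrad_apply, pd_Dx_add_single]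

theorem jetGrad_Dt (k : Fin m) (f : SmoothFn V) :
    jetGrad k (Dt f) = (jetGrad k f).mapRange Dt (by rw [← dtD_apply, map_zero]) +
      (jetGrad k f).mapDomain fun p => (p.1 + 1, p.2) := by
  have hinj : Function.Injective fun p : ℕ × (Fin n →₀ ℕ) => (p.1 + 1, p.2) := by
    rintro ⟨s, I⟩ ⟨s', I'⟩ hp
    simpa using hp
  ext1 ⟨s, K⟩
  rw [Finsupp.add_apply, Finsupp.mapRange_apply, jetGrad_apply, jetGrad_apply]
  cases s with
  | zero =>
    rw [Finsupp.mapDomain_of_notMem_range, add_zero, pd_Dt_zero]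
    rintro ⟨⟨s', I⟩, hp⟩
    simp at hp
  | succ s =>
    have := Finsupp.mapDomain_apply hinj (jetGrad k f) (s, K)
    simp only at this
    rw [this, jetGrad_apply, pd_Dt_succ]

/-- The Euler operator (variational derivative with respect to `u^k`). -/
def euler (k : Fin m) : SmoothFn V →+ SmoothFn V where
  toFun f := (jetGrad k f).sum fun p c => jetAdj p c
  map_zero' := by
    have : jetGrad k (0 : SmoothFn V) = 0 := by ext1 p; rw [jetGrad_apply, pd_zero]; rfl
    rw [this, Finsupp.sum_zero_index]
  map_add' f g := by
    have : jetGrad k (f + g) = jetGrad k f + jetGrad k g := by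
      ext1 p; rw [Finsupp.add_apply, jetGrad_apply, pd_add]; rfl
    rw [this, Finsupp.sum_add_index' (fun _ => map_zero _) fun _ => map_add _]

theorem euler_apply (k : Fin m) (f : SmoothFn V) :
    euler k f = (jetGrad k f).sum fun p c => jetAdj p c := rfl

theorem euler_Dx (k : Fin m) (j : Fin n) (f : SmoothFn V) : euler k (Dx j f) = 0 := by
  rw [euler_apply, jetGrad_Dx, Finsupp.sum_add_index' (fun _ => map_zero _) fun _ => map_add _,
    Finsupp.sum_mapRange_index fun _ => map_zero _,
    Finsupp.sum_mapDomain_index (fun _ => map_zero _) fun _ => map_add _, Finsupp.sum, Finsupp.sum,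
    ← Finset.sum_add_distrib]
  exact Finset.sum_eq_zero fun p _ => by rw [jetAdj_add_single, add_neg_cancel]

theorem euler_Dt (k : Fin m) (f : SmoothFn V) : euler k (Dt f) = 0 := by
  rw [euler_apply, jetGrad_Dt, Finsupp.sum_add_index' (fun _ => map_zero _) fun _ => map_add _,
    Finsupp.sum_mapRange_index fun _ => map_zero _,
    Finsupp.sum_mapDomain_index (fun _ => map_zero _) fun _ => map_add _, Finsupp.sum, Finsupp.sum,
    ← Finset.sum_add_distrib]
  exact Finset.sum_eq_zero fun p _ => by rw [jetAdj_succ, add_neg_cancel]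

/-- Integration by parts under the Euler operator. -/
theorem euler_mul_total_derivative (k : Fin m) (s : ℕ) (I : Fin n →₀ ℕ) (g e : SmoothFn V) :
    euler k (g * Dt^[s] (DxI I e)) = euler k (jetAdj (s, I) g * e) := by
  induction s generalizing g with
  | zero =>
    induction I using multiIndex_induction generalizing g with
    | h0 => rw [jetAdj_apply]; simp [DxI_zero_index]
    | hs I j ih =>
      have h1 : g * Dt^[0] (DxI (I + Finsupp.single j 1) e) =
          Dx j (g * Dt^[0] (DxI I e)) - Dx j g * Dt^[0] (DxI I e) := by
        simp only [Function.iterate_zero, id]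
        rw [DxI_add_single, Dx_mul]; ring
      rw [h1, map_sub, euler_Dx, ih, jetAdj_add_single, zero_sub, ← map_neg]
      congr 1
      ring
  | succ s ih =>
    have h1 : g * Dt^[s + 1] (DxI I e) =
        Dt (g * Dt^[s] (DxI I e)) - Dt g * Dt^[s] (DxI I e) := by
      rw [Function.iterate_succ_apply', Dt_mul]; ring
    rw [h1, map_sub, euler_Dt, ih, jetAdj_succ, zero_sub, ← map_neg]
    congr 1
    ring

end Euler

/-! ### Restriction to solutions and the equation for characteristics. -/

section Restriction

variable {U : TopologicalSpace.Opens (Coord n m (Fin h) → ℝ)} (F : Fin m → SmoothFn U)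

/-- The jet coordinates, expressed on the solutions of the system. -/
def resCoord : Coord n m ℕ → SmoothFn U
  | Coord.t => coordFn Coord.t
  | Coord.x j => coordFn (Coord.x j)
  | Coord.u k s I => if hs : s < h then coordFn (Coord.u k ⟨s, hs⟩ I)
      else DxI I ((DtBar F)^[s - h] (F k))

theorem resCoord_incl (θ : U) : (fun c => (resCoord F c).1 θ) ∘ Coord.incl = θ.1 := by
  funext c
  cases c with
  | t => rfl
  | x j => rfl
  | u k s I => simp [Coord.incl, resCoord, coordFn]

/-- Restriction of functions on the space of all jets to the solutions of the system. -/
def restrictJets : SmoothFn (fullJets U) →ₐ[ℝ] SmoothFn U :=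
  subst (resCoord F) fun θ => by
    change (fun c => (resCoord F c).1 θ) ∘ Coord.incl ∈ U
    rw [resCoord_incl]; exact θ.2

theorem restrictJets_coordFn (c : Coord n m ℕ) : restrictJets F (coordFn c) = resCoord F c := rfl

theorem restrictJets_lift (f : SmoothFn U) : restrictJets F (lift f) = f := by
  ext θ
  change f.1 ⟨(fun c => (resCoord F c).1 θ) ∘ Coord.incl, _⟩ = f.1 θ
  exact congrArg f.1 (Subtype.ext (resCoord_incl F θ))

theorem restrictJets_Dx (j : Fin n) (f : SmoothFn (fullJets U)) :
    restrictJets F (Dx j f) = Dx j (restrictJets F f) := by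
  rw [Dx_eq_vf, Dx_eq_vf]
  refine (vf_subst (resCoord F) _ (fun c => ?_) f).symm
  rw [← Dx_eq_vf]
  change Dx j (resCoord F c) = restrictJets F (dxW j c)
  cases c with
  | t => rw [resCoord, Dx_coordFn]; exact (map_zero _).symm
  | x i => rw [resCoord, Dx_coordFn]; simp only [dxW]; split_ifs <;> simp
  | u k s I =>
    simp only [dxW, restrictJets_coordFn, resCoord]
    split_ifs
    · rw [Dx_coordFn]; rfl
    · rw [DxI_add_single]

theorem restrictJets_Dt (f : SmoothFn (fullJets U)) :
    restrictJets F (Dt f) = DtBar F (restrictJets F f) := by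
  rw [Dt_eq_vf, DtBar_eq_vf]
  refine (vf_subst (resCoord F) _ (fun c => ?_) f).symm
  rw [← DtBar_eq_vf]
  change DtBar F (resCoord F c) = restrictJets F (dtW c)
  cases c with
  | t => rw [resCoord, DtBar_coordFn]; exact (map_one _).symm
  | x i => rw [resCoord, DtBar_coordFn]; exact (map_zero _).symm
  | u k s I =>
    simp only [dtW, restrictJets_coordFn, resCoord]
    by_cases hs : s < h
    · rw [dif_pos hs, DtBar_coordFn]
      simp only [dtbW]
      split_ifs with hs'
      · rfl
      -- The step from $u_{h-1,I}$ to $u_{h,I}$, which restricts to $\bar D_x^IF^k$ with no further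
      -- time derivative.
      · rw [show s + 1 - h = 0 by omega]; rfl
    · rw [dif_neg hs, dif_neg (by omega), DtBar_DxI_comm, ← Function.iterate_succ_apply' (DtBar F),
        show s + 1 - h = (s - h).succ by omega]

theorem restrictJets_DxI (I : Fin n →₀ ℕ) (f : SmoothFn (fullJets U)) :
    restrictJets F (DxI I f) = DxI I (restrictJets F f) := by
  induction I using multiIndex_induction with
  | h0 => simp only [DxI_zero_index]
  | hs I j ih => rw [DxI_add_single, DxI_add_single, restrictJets_Dx, ih]

theorem restrictJets_iterate_Dt (s : ℕ) (f : SmoothFn (fullJets U)) :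
    restrictJets F (Dt^[s] f) = (DtBar F)^[s] (restrictJets F f) :=
  (Function.Semiconj.iterate_right (restrictJets_Dt F) s) f

theorem restrictJets_eqn (k : Fin m) : restrictJets F (eqn F k) = 0 := by
  rw [eqn, map_sub, restrictJets_lift, restrictJets_coordFn]
  simp [resCoord, DxI_zero_index]

theorem restrictJets_eq_zero {f : SmoothFn (fullJets U)} (hf : f ∈ eqnIdeal F) :
    restrictJets F f = 0 := by
  have : eqnIdeal F ≤ RingHom.ker (restrictJets F) := by
    refine Ideal.span_le.2 ?_
    rintro _ ⟨k, s, I, rfl⟩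
    rw [SetLike.mem_coe, RingHom.mem_ker, restrictJets_iterate_Dt, restrictJets_DxI,
      restrictJets_eqn, DxI_zero, ← dtbPow_apply, map_zero]
  exact RingHom.mem_ker.1 (this hf)

theorem Coord.incl_injective : Function.Injective (Coord.incl : Coord n m (Fin h) → _) := by
  intro c c' hc
  cases c <;> cases c' <;> simp_all [Coord.incl, Fin.val_inj]

theorem coordFn_incl_mem (θ : fullJets U) :
    (fun c : Coord n m (Fin h) => (coordFn c.incl : SmoothFn (fullJets U)).1 θ) ∈ U := θ.2

theorem lift_eq_subst (f : SmoothFn U) :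
    lift f = subst (V := U) (U := fullJets U) (fun c => coordFn c.incl) coordFn_incl_mem f := rfl

theorem pd_lift (c : Coord n m ℕ) (f : SmoothFn U) (c' : Coord n m (Fin h)) (hc : c = c'.incl) :
    pd c (lift f) = lift (pd c' f) := by
  classical
  rw [lift_eq_subst, pd_subst, lift_eq_subst]
  by_cases hs : c' ∈ supp f
  · rw [Finset.sum_eq_single c']
    · rw [pd_coordFn, if_pos hc, mul_one]
    · intro b _ hb
      rw [pd_coordFn, if_neg, mul_zero]
      rw [hc]
      exact fun e => hb (Coord.incl_injective e).symm
    · exact fun h' => absurd hs h'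
  · rw [pd_eq_zero_of_notMem_supp hs, map_zero]
    refine Finset.sum_eq_zero fun b hb => ?_
    rw [pd_coordFn, if_neg, mul_zero]
    rw [hc]
    rintro e
    exact hs (Coord.incl_injective e ▸ hb)

theorem pd_lift_of_le {k : Fin m} {s : ℕ} {I : Fin n →₀ ℕ} (hs : h ≤ s) (f : SmoothFn U) :
    pd (Coord.u k s I) (lift f) = 0 := by
  classical
  rw [lift_eq_subst, pd_subst]
  refine Finset.sum_eq_zero fun b _ => ?_
  rw [pd_coordFn, if_neg, mul_zero]
  cases b with
  | t => simp [Coord.incl]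
  | x j => simp [Coord.incl]
  | u k' s' I' =>
    simp only [Coord.incl, Coord.u.injEq, not_and]
    have := s'.2
    omega

theorem restrictJets_pd_lift (k : Fin m) (s : ℕ) (I : Fin n →₀ ℕ) (f : SmoothFn U) :
    restrictJets F (pd (Coord.u k s I) (lift f)) = pdu k s I f := by
  by_cases hs : s < h
  · rw [pd_lift (Coord.u k s I) f (Coord.u k ⟨s, hs⟩ I) rfl, restrictJets_lift, pdu, dif_pos hs]
  · rw [pd_lift_of_le (by omega), map_zero, pdu, dif_neg hs]

open Classical in
theorem restrictJets_pd_eqn (k l : Fin m) (p : ℕ × (Fin n →₀ ℕ)) :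
    restrictJets F (pd (Coord.u k p.1 p.2) (eqn F l)) =
      (if k = l ∧ p = (h, 0) then 1 else 0) - pdu k p.1 p.2 (F l) := by
  rw [eqn, pd_sub, map_sub, restrictJets_pd_lift, pd_coordFn]
  congr 1
  simp only [Coord.u.injEq, Prod.ext_iff]
  split_ifs <;> simp

/-- The operator `(-1)^{s+|I|} D̄_t^s D̄_x^I`. -/
def barAdj (p : ℕ × (Fin n →₀ ℕ)) : SmoothFn U →+ SmoothFn U :=
  (AddMonoidHom.mulLeft ((-1) ^ (p.1 + p.2.degree))).comp ((dtbPow F p.1).comp (dxIHom p.2))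

theorem barAdj_apply (p : ℕ × (Fin n →₀ ℕ)) (f : SmoothFn U) :
    barAdj F p f = (-1) ^ (p.1 + p.2.degree) * (DtBar F)^[p.1] (DxI p.2 f) := by
  rw [← dtbPow_apply]
  rfl

theorem restrictJets_jetAdj (p : ℕ × (Fin n →₀ ℕ)) (f : SmoothFn (fullJets U)) :
    restrictJets F (jetAdj p f) = barAdj F p (restrictJets F f) := by
  rw [jetAdj_apply, barAdj_apply, map_mul, restrictJets_iterate_Dt, restrictJets_DxI]
  simp

theorem finite_pdu_ne_zero (k : Fin m) (f : SmoothFn U) :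
    {p : ℕ × (Fin n →₀ ℕ) | pdu k p.1 p.2 f ≠ 0}.Finite := by
  refine Set.Finite.subset ((finite_pd_ne_zero f).image fun c => match c with
    | Coord.t => (0, 0)
    | Coord.x _ => (0, 0)
    | Coord.u _ s I => (s.1, I)) ?_
  rintro ⟨s, I⟩ hp
  simp only [pdu, Set.mem_ofPred_eq] at hp
  split_ifs at hp with hs
  · exact ⟨Coord.u k ⟨s, hs⟩ I, hp, rfl⟩
  · exact absurd rfl hp

/-- In generalized evolution form the gradient of $F^l$ lives on the two axes $s=0$ and $I=0$; their
common point $(0,0)$ goes to the first sum, so the second starts at $s=1$. -/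
theorem sum_barAdj_eq_adjL (hF : IsGenEvolution F) (k l : Fin m) (ψ : SmoothFn U)
    (T : Finset (ℕ × (Fin n →₀ ℕ))) (hT : ∀ p, pdu k p.1 p.2 (F l) ≠ 0 → p ∈ T) :
    ∑ p ∈ T, barAdj F p (pdu k p.1 p.2 (F l) * ψ) = adjL F k l ψ := by
  classical
  set X : ℕ × (Fin n →₀ ℕ) → SmoothFn U := fun p => barAdj F p (pdu k p.1 p.2 (F l) * ψ) with hX
  have hX0 : ∀ p, X p ≠ 0 → pdu k p.1 p.2 (F l) ≠ 0 := by
    intro p hp h0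
    apply hp
    simp only [hX, h0, zero_mul, map_zero]
  set A := T.image Prod.snd with hA
  set T' : Finset (ℕ × (Fin n →₀ ℕ)) := ({0} ×ˢ A) ∪ (Finset.Ico 1 h ×ˢ {0}) with hT'
  have h1 : ∑ p ∈ T, X p = ∑ p ∈ T', X p := by
    rw [← finsum_eq_sum_of_support_subset X (s := T) fun p hp => hT p (hX0 p hp),
      ← finsum_eq_sum_of_support_subset X (s := T') fun p hp => ?_]
    have hp' := hX0 p hp
    have hpT := hT p hp'
    obtain ⟨s, I⟩ := p
    by_cases hs : s = 0
    · subst hs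
      rw [Finset.mem_coe, hT', Finset.mem_union]
      left
      simpa [hA] using ⟨0, hpT⟩
    · have hI : I = 0 := by
        by_contra hI
        exact hp' (hF l k s I hs hI)
      subst hI
      have hsh : s < h := by
        by_contra hsh
        apply hp'
        simp only [pdu, dif_neg hsh]
      simp only [hT', Finset.coe_union, Finset.coe_product, Set.mem_union, Set.mem_prod,
        Finset.mem_coe, Finset.mem_singleton, Finset.mem_Ico]
      right
      exact ⟨by omega, by simp⟩
  have hdisj : Disjoint (({0} : Finset ℕ) ×ˢ A) (Finset.Ico 1 h ×ˢ {0}) := by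
    rw [Finset.disjoint_left]
    rintro ⟨s, I⟩ hp hq
    simp only [Finset.mem_product, Finset.mem_singleton, Finset.mem_Ico] at hp hq
    omega
  rw [h1, hT', Finset.sum_union hdisj, Finset.sum_product, Finset.sum_product,
    Finset.sum_singleton, adjL]
  congr 1
  · rw [finsum_eq_sum_of_support_subset _ (s := A)]
    · refine Finset.sum_congr rfl fun I _ => ?_
      simp only [hX, barAdj_apply, zero_add, Function.iterate_zero, id]
    · intro I hI
      have : (0, I) ∈ T := hT _ fun h0 => hI (by
        simp only at h0
        simp only [h0, zero_mul, DxI_zero, mul_zero])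
      simpa [hA] using ⟨0, this⟩
  · refine Finset.sum_congr rfl fun s _ => ?_
    simp only [hX, Finset.sum_singleton, barAdj_apply, DxI_zero_index, map_zero, add_zero]

/-- The characteristic of a conservation law lies in the kernel of the adjoint linearization. -/
theorem characteristic_equation (hF : IsGenEvolution F) {J₀ : SmoothFn U} {J : Fin n → SmoothFn U}
    {χ : Fin m → SmoothFn U} (hχ : IsCharacteristic F J₀ J χ) (k : Fin m) :
    (-1) ^ h * (DtBar F)^[h] (χ k) = ∑ l, adjL F k l (χ l) := by
  classical
  obtain ⟨K₀, K, g, -, -, hdiv, hg⟩ := hχ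
  set G : Fin m → SmoothFn (fullJets U) := fun k => (g k).sum fun p c => jetAdj p c with hG
  have hGχ : ∀ l, restrictJets F (G l) = χ l := by
    intro l
    have := restrictJets_eq_zero F (hg l)
    rw [map_sub, restrictJets_lift, sub_eq_zero] at this
    rw [← this]
    congr 1
  -- Under the Euler operator every $g\,D_t^sD_x^I$ acting on an equation may be replaced by its
  -- adjoint applied to $g$, times the equation.
  have hE : euler k (∑ l, G l * eqn F l) = 0 := by
    have h0 : euler k (Dt K₀ + ∑ i, Dx i (K i)) = 0 := by
      rw [map_add, euler_Dt, map_sum, zero_add]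
      exact Finset.sum_eq_zero fun i _ => euler_Dx _ _ _
    rw [hdiv, map_sum] at h0
    rw [map_sum, ← h0]
    refine Finset.sum_congr rfl fun l _ => ?_
    simp only [hG, Finsupp.sum]
    rw [Finset.sum_mul, map_sum, map_sum]
    exact Finset.sum_congr rfl fun p _ => (euler_mul_total_derivative k p.1 p.2 _ _).symm
  set f := ∑ l, G l * eqn F l with hf
  -- In the product rule the terms with an undifferentiated equation vanish on solutions.
  have hpd : ∀ p : ℕ × (Fin n →₀ ℕ), restrictJets F (pd (Coord.u k p.1 p.2) f) =
      (if p = (h, 0) then χ k else 0) - ∑ l, pdu k p.1 p.2 (F l) * χ l := by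
    intro p
    rw [hf, pd_sum, map_sum]
    have : ∀ l, restrictJets F (pd (Coord.u k p.1 p.2) (G l * eqn F l)) =
        (if k = l then if p = (h, 0) then χ k else 0 else 0) - pdu k p.1 p.2 (F l) * χ l := by
      intro l
      rw [pd_mul, map_add, map_mul, map_mul, restrictJets_eqn, zero_mul, add_zero, hGχ,
        restrictJets_pd_eqn, mul_sub, mul_comm (χ l) (pdu _ _ _ _)]
      congr 1
      by_cases hkl : k = l
      · subst hkl; simp
      · simp [hkl]
    simp only [this, Finset.sum_sub_distrib, Finset.sum_ite_eq, Finset.mem_univ, if_true]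
  set T : Finset (ℕ × (Fin n →₀ ℕ)) := (jetGrad k f).support ∪ {(h, 0)} ∪
    Finset.univ.biUnion fun l => (finite_pdu_ne_zero k (F l)).toFinset with hT
  have hsum : ∑ p ∈ T, barAdj F p (restrictJets F (pd (Coord.u k p.1 p.2) f)) = 0 := by
    have h0 := congrArg (restrictJets F) hE
    rw [euler_apply, Finsupp.sum_of_support_subset (s := T) _
      (Finset.subset_union_left.trans Finset.subset_union_left) _ fun _ _ => map_zero _,
      map_sum, map_zero] at h0
    rw [← h0]
    exact Finset.sum_congr rfl fun p _ => (restrictJets_jetAdj F p _).symm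
  simp only [hpd, map_sub, map_sum, Finset.sum_sub_distrib] at hsum
  rw [Finset.sum_eq_single (h, 0), if_pos rfl, Finset.sum_comm, sub_eq_zero, barAdj_apply] at hsum
  · simp only [map_zero, add_zero, DxI_zero_index] at hsum
    rw [hsum]
    refine Finset.sum_congr rfl fun l _ => sum_barAdj_eq_adjL F hF k l _ T fun p hp => ?_
    rw [hT, Finset.mem_union, Finset.mem_biUnion]
    exact Or.inr ⟨l, Finset.mem_univ _, by simpa using hp⟩
  · intro p _ hp
    rw [if_neg hp, map_zero]
  · intro hn
    exact absurd (Finset.mem_union_left _ (Finset.mem_union_right _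
      (Finset.mem_singleton_self _))) hn

end Restriction

end Characteristics

/-! ### Orders and symbols of iterated total derivatives. -/

section OrderEstimates

section Leibniz

variable {R : Type*} [CommRing R] [Algebra ℝ R] (D : Derivation ℝ R R)

theorem derivation_natCast_mul (q : ℕ) (x : R) : D (q * x) = q * D x := by
  rw [Derivation.leibniz, Derivation.map_natCast, smul_zero, add_zero, smul_eq_mul]

/-- Pascal's rule for an arbitrary sequence `G`: it serves the Leibniz formula for products and also
`pd_iterate_vf`, where `G` consists of partial derivatives of iterated derivatives of a coordinate.
-/
theorem sum_leibniz_succ (x : R) (G : ℕ → R) (i : ℕ) :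
    ∑ j ∈ Finset.range (i + 2), (i + 1).choose j * D^[i + 1 - j] x * G j =
      ∑ j ∈ Finset.range (i + 1), (D (i.choose j * D^[i - j] x) * G j +
        i.choose j * D^[i - j] x * G (j + 1)) := by
  have := Finset.sum_choose_succ_mul (fun a b => D^[b] x * G a) i
  simp only [← mul_assoc] at this
  rw [this, Finset.sum_add_distrib]
  congr 1
  refine Finset.sum_congr rfl fun j hj => ?_
  rw [derivation_natCast_mul, ← Function.iterate_succ_apply' D,
    show i + 1 - j = (i - j).succ by have := Finset.mem_range.1 hj; omega]

theorem iterate_derivation_mul (i : ℕ) (x y : R) :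
    D^[i] (x * y) = ∑ j ∈ Finset.range (i + 1), i.choose j * D^[i - j] x * D^[j] y := by
  induction i with
  | zero => simp
  | succ i ih =>
    rw [sum_leibniz_succ, Function.iterate_succ_apply', ih, map_sum]
    refine Finset.sum_congr rfl fun j _ => ?_
    rw [Derivation.leibniz, smul_eq_mul, smul_eq_mul, Function.iterate_succ_apply' D j]
    ring

end Leibniz

section Iterate

variable {ι : Type} {U : TopologicalSpace.Opens (ι → ℝ)}

/-- The differential of an iterated derivative, in terms of the differentials of the iterated
derivatives of the coordinates. -/
theorem pd_iterate_vf (w : ι → SmoothFn U) (f : SmoothFn U) (i : ℕ) (c : ι) :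
    pd c ((vf w)^[i] f) = ∑ c' ∈ supp f, ∑ j ∈ Finset.range (i + 1),
      i.choose j * (vf w)^[i - j] (pd c' f) * pd c ((vf w)^[j] (coordFn c')) := by
  classical
  induction i generalizing c with
  | zero =>
    simp only [Function.iterate_zero, id, zero_add, Finset.sum_range_one, Nat.choose_self,
      Nat.cast_one, one_mul, pd_coordFn, mul_ite, mul_one, mul_zero, Finset.sum_ite_eq]
    split_ifs with hc
    · rfl
    · exact pd_eq_zero_of_notMem_supp hc
  | succ i ih =>
    rw [Function.iterate_succ_apply', pd_vf]
    -- The induction hypothesis holds for all `c`, so it is an identity between differentials and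
    -- may be evaluated along the commutator field $[\partial_c,w]$.
    have h1 : vf (fun c' => pd c (w c')) ((vf w)^[i] f) =
        ∑ c' ∈ supp f, ∑ j ∈ Finset.range (i + 1), i.choose j * (vf w)^[i - j] (pd c' f) *
          vf (fun c' => pd c (w c')) ((vf w)^[j] (coordFn c')) := by
      have := vf_eq_of_pd_eq (A := supp f ×ˢ Finset.range (i + 1)) (g := (vf w)^[i] f)
        (L := fun a => i.choose a.2 * (vf w)^[i - a.2] (pd a.1 f))
        (G := fun a => (vf w)^[a.2] (coordFn a.1)) (fun c => by rw [ih c, Finset.sum_product])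
        (fun c' => pd c (w c'))
      rw [this, Finset.sum_product]
    rw [h1, ih c, ← vfD_apply, map_sum (vfD w), ← Finset.sum_add_distrib]
    refine Finset.sum_congr rfl fun c' _ => ?_
    rw [map_sum (vfD w), ← Finset.sum_add_distrib]
    refine Eq.trans ?_ (sum_leibniz_succ (vfD w) (pd c' f)
      (fun j => pd c ((vf w)^[j] (coordFn c'))) i).symm
    refine Finset.sum_congr rfl fun j _ => ?_
    rw [Derivation.leibniz, smul_eq_mul, smul_eq_mul, Function.iterate_succ_apply' (vf w) j, pd_vf]
    simp only [vfD_apply, show ⇑(vfD w) = vf w from rfl]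
    ring

end Iterate

variable {n m h : ℕ} {U : TopologicalSpace.Opens (Coord n m (Fin h) → ℝ)}

section Pdu

/-- `pdu k s K` as a derivation. -/
def pduD (k : Fin m) (s : ℕ) (K : Fin n →₀ ℕ) : Derivation ℝ (SmoothFn U) (SmoothFn U) :=
  if hs : s < h then pdD (Coord.u k ⟨s, hs⟩ K) else 0

theorem pduD_apply (k : Fin m) (s : ℕ) (K : Fin n →₀ ℕ) (f : SmoothFn U) :
    pduD k s K f = pdu k s K f := by
  unfold pduD pdu
  split_ifs <;> rfl

theorem pdu_val (k : Fin m) (s : Fin h) (K : Fin n →₀ ℕ) (f : SmoothFn U) :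
    pdu k s K f = pd (Coord.u k s K) f := by
  simp [pdu]

theorem pdu_of_le {k : Fin m} {s : ℕ} (hs : h ≤ s) (K : Fin n →₀ ℕ) (f : SmoothFn U) :
    pdu k s K f = 0 := by
  simp [pdu, hs]

theorem pdu_zero (k : Fin m) (s : ℕ) (K : Fin n →₀ ℕ) : pdu k s K (0 : SmoothFn U) = 0 := by
  rw [← pduD_apply, map_zero]

theorem pdu_one (k : Fin m) (s : ℕ) (K : Fin n →₀ ℕ) : pdu k s K (1 : SmoothFn U) = 0 := by
  rw [← pduD_apply, Derivation.map_one_eq_zero]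

theorem pdu_mul (k : Fin m) (s : ℕ) (K : Fin n →₀ ℕ) (f g : SmoothFn U) :
    pdu k s K (f * g) = f * pdu k s K g + g * pdu k s K f := by
  simp only [← pduD_apply, Derivation.leibniz, smul_eq_mul]

theorem pdu_sum {α : Type*} (k : Fin m) (s : ℕ) (K : Fin n →₀ ℕ) (S : Finset α)
    (f : α → SmoothFn U) : pdu k s K (∑ a ∈ S, f a) = ∑ a ∈ S, pdu k s K (f a) := by
  simp only [← pduD_apply, map_sum]

theorem pdu_coordFn_t (k : Fin m) (s : ℕ) (K : Fin n →₀ ℕ) :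
    pdu k s K (coordFn Coord.t : SmoothFn U) = 0 := by
  classical
  unfold pdu
  split_ifs
  · simp [pd_coordFn]
  · rfl

theorem pdu_coordFn_x (k : Fin m) (s : ℕ) (K : Fin n →₀ ℕ) (j : Fin n) :
    pdu k s K (coordFn (Coord.x j) : SmoothFn U) = 0 := by
  classical
  unfold pdu
  split_ifs
  · simp [pd_coordFn]
  · rfl

theorem pdu_coordFn_u_of_ne {k k' : Fin m} {s : ℕ} {s' : Fin h} {K K' : Fin n →₀ ℕ}
    (hne : ¬ (k = k' ∧ s = s'.1 ∧ K = K')) :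
    pdu k s K (coordFn (Coord.u k' s' K') : SmoothFn U) = 0 := by
  classical
  unfold pdu
  split_ifs with hs
  · rw [pd_coordFn, if_neg]
    intro hc
    simp only [Coord.u.injEq] at hc
    exact hne ⟨hc.1, by rw [← hc.2.1], hc.2.2⟩
  · rfl

theorem pdu_Dx_add_single (j : Fin n) (k : Fin m) (s : ℕ) (K : Fin n →₀ ℕ) (f : SmoothFn U) :
    pdu k s (K + Finsupp.single j 1) (Dx j f) =
      Dx j (pdu k s (K + Finsupp.single j 1) f) + pdu k s K f := by
  unfold pdu
  split_ifs
  · exact pd_Dx_add_single _ _ _ _ _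
  · rw [Dx_zero, add_zero]

theorem pdu_Dx_of_eq_zero (j : Fin n) (k : Fin m) (s : ℕ) (K : Fin n →₀ ℕ) (hK : K j = 0)
    (f : SmoothFn U) : pdu k s K (Dx j f) = Dx j (pdu k s K f) := by
  unfold pdu
  split_ifs
  · exact pd_Dx_of_eq_zero _ _ _ _ hK _
  · rw [Dx_zero]

theorem pdu_iterate_DtBar (F : Fin m → SmoothFn U) (f : SmoothFn U) (i : ℕ) (k : Fin m) (s : ℕ)
    (K : Fin n →₀ ℕ) : pdu k s K ((DtBar F)^[i] f) = ∑ c' ∈ supp f, ∑ j ∈ Finset.range (i + 1),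
      i.choose j * (DtBar F)^[i - j] (pd c' f) * pdu k s K ((DtBar F)^[j] (coordFn c')) := by
  by_cases hs : s < h
  · simp only [pdu, dif_pos hs]
    rw [DtBar_eq_vf]
    exact pd_iterate_vf _ _ _ _
  · simp only [pdu, dif_neg hs, mul_zero, Finset.sum_const_zero]

end Pdu

section OrderBounds

/-- The space order of `f` is at most `a`. -/
def OrdLE (a : ℕ) (f : SmoothFn U) : Prop :=
  ∀ k s (K : Fin n →₀ ℕ), a < K.degree → pdu k s K f = 0

/-- The space order of `f` is at most `a`, and the derivatives of space order `a` on which `f`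
depends have time order at most `b`. -/
def LexLE (a b : ℕ) (f : SmoothFn U) : Prop :=
  ∀ k s (K : Fin n →₀ ℕ), (a < K.degree ∨ K.degree = a ∧ b < s) → pdu k s K f = 0

theorem LexLE.ordLE {a b : ℕ} {f : SmoothFn U} (hf : LexLE a b f) : OrdLE a f :=
  fun k s K hK => hf k s K (Or.inl hK)

theorem exists_eq_add_single {K : Fin n →₀ ℕ} {j : Fin n} (hK : K j ≠ 0) :
    ∃ I, K = I + Finsupp.single j 1 :=
  ⟨K - Finsupp.single j 1, (tsub_add_cancel_of_le (by
    rw [Finsupp.single_le_iff]; omega)).symm⟩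

theorem degree_add_single (I : Fin n →₀ ℕ) (j : Fin n) :
    (I + Finsupp.single j 1).degree = I.degree + 1 := by
  rw [map_add, Finsupp.degree_single]

theorem LexLE.apply_Dx {a b : ℕ} {f : SmoothFn U} (hf : LexLE a b f) (j : Fin n) :
    LexLE (a + 1) b (Dx j f) := by
  intro k s K hK
  by_cases hj : K j = 0
  · rw [pdu_Dx_of_eq_zero _ _ _ _ hj, hf k s K (by omega), Dx_zero]
  · obtain ⟨I, rfl⟩ := exists_eq_add_single hj
    have hd := degree_add_single I j
    rw [pdu_Dx_add_single, hf k s _ (by omega), hf k s I (by omega), Dx_zero, add_zero]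

theorem OrdLE.apply_Dx {a : ℕ} {f : SmoothFn U} (hf : OrdLE a f) (j : Fin n) :
    OrdLE (a + 1) (Dx j f) := by
  -- With time bound `h` the second condition of `LexLE` is void, since no coordinate has time order
  -- above `h`.
  have h1 : LexLE a h f := by
    rintro k s K (hK | hK)
    · exact hf k s K hK
    · exact pdu_of_le hK.2.le K f
  exact (h1.apply_Dx j).ordLE

theorem LexLE.apply_DxI {a b : ℕ} {f : SmoothFn U} (hf : LexLE a b f) (I : Fin n →₀ ℕ) :
    LexLE (a + I.degree) b (DxI I f) := by
  induction I using multiIndex_induction with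
  | h0 => simpa [DxI_zero_index] using hf
  | hs I j ih => rw [DxI_add_single, degree_add_single, ← add_assoc]; exact ih.apply_Dx j

theorem OrdLE.apply_DxI {a : ℕ} {f : SmoothFn U} (hf : OrdLE a f) (I : Fin n →₀ ℕ) :
    OrdLE (a + I.degree) (DxI I f) := by
  induction I using multiIndex_induction with
  | h0 => simpa [DxI_zero_index] using hf
  | hs I j ih => rw [DxI_add_single, degree_add_single, ← add_assoc]; exact ih.apply_Dx j

theorem mem_finsuppAntidiag_univ {a : ℕ} {K : Fin n →₀ ℕ} :
    K ∈ Finset.finsuppAntidiag Finset.univ a ↔ K.degree = a := by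
  rw [Finset.mem_finsuppAntidiag', Finsupp.degree_eq_sum, Finsupp.sum_fintype _ _ fun _ => rfl]
  simp

/-- The generating polynomial of the derivatives `∂f/∂u^j_{b,K}`, `|K| = a`. -/
def sym (a b : ℕ) (j : Fin m) (f : SmoothFn U) : MvPolynomial (Fin n) (SmoothFn U) :=
  ∑ K ∈ Finset.finsuppAntidiag Finset.univ a, MvPolynomial.monomial K (pdu j b K f)

theorem symbolAt_apply {p : ℕ} (a b : ℕ) (f : Fin p → SmoothFn U) (i : Fin p) (j : Fin m) :
    symbolAt a b f i j = sym a b j (f i) := rfl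

theorem coeff_sym (a b : ℕ) (j : Fin m) (f : SmoothFn U) (K : Fin n →₀ ℕ) :
    MvPolynomial.coeff K (sym a b j f) = if K.degree = a then pdu j b K f else 0 := by
  classical
  rw [sym, MvPolynomial.coeff_sum]
  simp only [MvPolynomial.coeff_monomial, Finset.sum_ite_eq', mem_finsuppAntidiag_univ]

theorem sym_congr {a b b' : ℕ} {j : Fin m} {f g : SmoothFn U}
    (hfg : ∀ K : Fin n →₀ ℕ, K.degree = a → pdu j b K f = pdu j b' K g) :
    sym a b j f = sym a b' j g :=
  Finset.sum_congr rfl fun K hK => by rw [hfg K (mem_finsuppAntidiag_univ.1 hK)]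

/-- At order $a+1$ the terms where $D_{x_i}$ hits the coefficients of the gradient disappear; only
the shift of indices remains, and it is multiplication by $q_i$. -/
theorem sym_Dx {a : ℕ} {f : SmoothFn U} (hf : OrdLE a f) (b : ℕ) (j : Fin m) (i : Fin n) :
    sym (a + 1) b j (Dx i f) = MvPolynomial.X i * sym a b j f := by
  classical
  ext1 K
  rw [MvPolynomial.coeff_X_mul', coeff_sym]
  by_cases hi : K i = 0
  · rw [if_neg (c := i ∈ K.support) (by simpa using hi)]
    split_ifs with hK
    · rw [pdu_Dx_of_eq_zero _ _ _ _ hi, hf j b K (by omega), Dx_zero]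
    · rfl
  · obtain ⟨I, rfl⟩ := exists_eq_add_single hi
    rw [if_pos (c := i ∈ Finsupp.support _) (Finsupp.mem_support_iff.2 hi), add_tsub_cancel_right, coeff_sym, degree_add_single]
    simp only [add_left_inj]
    split_ifs with hK
    · rw [pdu_Dx_add_single, hf j b _ (by rw [degree_add_single]; omega), Dx_zero, zero_add]
    · rfl

theorem sym_DxI {a : ℕ} {f : SmoothFn U} (hf : OrdLE a f) (b : ℕ) (j : Fin m) (I : Fin n →₀ ℕ) :
    sym (a + I.degree) b j (DxI I f) = MvPolynomial.monomial I 1 * sym a b j f := by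
  induction I using multiIndex_induction with
  | h0 => simp [DxI_zero_index]
  | hs I i ih =>
    rw [DxI_add_single, degree_add_single, ← add_assoc, sym_Dx (hf.apply_DxI I), ih, ← mul_assoc,
      MvPolynomial.X, MvPolynomial.monomial_mul, one_mul, add_comm I]

end OrderBounds

/-! ### Time derivatives on the system. -/

section TimeDerivatives

variable (F : Fin m → SmoothFn U)

theorem iterate_DtBar_coordFn_u (l : Fin m) (s : Fin h) (I : Fin n →₀ ℕ) (i : ℕ) :
    (DtBar F)^[i] (coordFn (Coord.u l s I)) = resCoord F (Coord.u l (s + i) I) := by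
  induction i with
  | zero => simp [resCoord]
  | succ i ih =>
    rw [Function.iterate_succ_apply', ih, ← restrictJets_coordFn, ← restrictJets_Dt, Dt_eq_vf,
      vf_coordFn]
    rfl

theorem iterate_DtBar_one (i : ℕ) : (DtBar F)^[i] 1 = 1 ∨ (DtBar F)^[i] 1 = 0 := by
  induction i with
  | zero => exact Or.inl rfl
  | succ i ih =>
    right
    rw [Function.iterate_succ_apply']
    rcases ih with h1 | h1 <;> rw [h1, DtBar_eq_vf]
    · exact vf_one _
    · exact vf_zero _

theorem pdu_iterate_DtBar_t (k : Fin m) (s : ℕ) (K : Fin n →₀ ℕ) (i : ℕ) :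
    pdu k s K ((DtBar F)^[i] (coordFn Coord.t)) = 0 := by
  cases i with
  | zero => exact pdu_coordFn_t k s K
  | succ i =>
    rw [Function.iterate_succ_apply, DtBar_coordFn, dtbW]
    rcases iterate_DtBar_one F i with h1 | h1 <;> rw [h1]
    · exact pdu_one k s K
    · exact pdu_zero k s K

theorem pdu_iterate_DtBar_x (k : Fin m) (s : ℕ) (K : Fin n →₀ ℕ) (j : Fin n) (i : ℕ) :
    pdu k s K ((DtBar F)^[i] (coordFn (Coord.x j))) = 0 := by
  cases i with
  | zero => exact pdu_coordFn_x k s K j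
  | succ i =>
    rw [Function.iterate_succ_apply, DtBar_coordFn, dtbW, ← dtbPow_apply, map_zero, pdu_zero]

variable {F} {N : ℕ} (hF : IsGenEvolution F) (hN : 0 < N) (hFN : ∀ l, OrdLE N (F l))

include hF hN hFN in
-- The gradient of $\bar D_t^pF^l$ is expanded over the coordinates occurring in $F^l$. A pure space
-- derivative $u_{0,I}$ turns into the coordinate $u_{i,I}$, $i\le p<h$, and the conditions on $K$
-- and $s$ leave only $i=s=p$. A pure time derivative $u_{s',0}$ turns into a coordinate of space
-- order $0<N$ or into $\bar D_t^{s'+i-h}F$, where $s'+i-h<p$ and induction applies.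
theorem pdu_iterate_DtBar_rhs (p : ℕ) (hp : p < h) (l j : Fin m) (s : ℕ) (K : Fin n →₀ ℕ)
    (hK : N ≤ K.degree) (hs : N < K.degree ∨ p ≤ s) :
    pdu j s K ((DtBar F)^[p] (F l)) = if s = p then pdu j 0 K (F l) else 0 := by
  classical
  induction p using Nat.strong_induction_on generalizing l j s K with
  | _ p ih =>
    have term : ∀ c' ∈ supp (F l), ∀ i ∈ Finset.range (p + 1),
        p.choose i * (DtBar F)^[p - i] (pd c' (F l)) * pdu j s K ((DtBar F)^[i] (coordFn c')) =
        if c' = Coord.u j ⟨0, by omega⟩ K then (if i = p then (if s = p then pdu j 0 K (F l) else 0)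
          else 0) else 0 := by
      intro c' hc' i hi
      have hi' : i ≤ p := Nat.lt_succ_iff.1 (Finset.mem_range.1 hi)
      cases c' with
      | t => simp [pdu_iterate_DtBar_t]
      | x q => simp [pdu_iterate_DtBar_x]
      | u k' s' I =>
        have hne := mem_supp.1 hc'
        rw [← pdu_val] at hne
        have hI : I.degree ≤ N := not_lt.1 fun hlt => hne (hFN l k' s' I hlt)
        rw [iterate_DtBar_coordFn_u]
        by_cases hs0 : (s' : ℕ) = 0
        · have hs' : s' = ⟨0, by omega⟩ := Fin.ext hs0
          rw [resCoord, dif_pos (by omega)]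
          by_cases heq : j = k' ∧ s = s' + i ∧ K = I
          · obtain ⟨rfl, hsi, rfl⟩ := heq
            have hip : i = p := by omega
            subst hip
            rw [if_pos (by rw [hs']), if_pos rfl, if_pos (by omega), Nat.choose_self, Nat.cast_one,
              one_mul, Nat.sub_self]
            have hone : pdu j s K (coordFn (Coord.u j ⟨s' + i, by omega⟩ K) : SmoothFn U) = 1 := by
              rw [pdu, dif_pos (by omega), pd_coordFn, if_pos (by simp [hsi])]
            rw [hone, mul_one, Function.iterate_zero, id, ← pdu_val, hs0]
          · rw [pdu_coordFn_u_of_ne heq, mul_zero]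
            split_ifs with h1 h2 h3
            · exfalso
              simp only [Coord.u.injEq] at h1
              exact heq ⟨h1.1.symm, by omega, h1.2.2.symm⟩
            all_goals rfl
        · have hI0 : I = 0 := by
            by_contra hI0
            exact hne (hF l k' s' I hs0 hI0)
          subst hI0
          rw [if_neg (by
            intro h1
            simp only [Coord.u.injEq] at h1
            exact hs0 (by rw [h1.2.1]))]
          rw [resCoord]
          split_ifs with hlt
          · rw [pdu_coordFn_u_of_ne, mul_zero]
            rintro ⟨-, -, rfl⟩
            simp at hK
            omega
          · have := s'.2
            rw [DxI_zero_index, ih (s' + i - h) (by omega) (by omega) k' j s K hK (by omega)]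
            split_ifs with h1
            -- Here $s=s'+i-h<p$, so the alternative $p\le s$ fails and $|K|>N$.
            · rw [hFN k' j 0 K (by omega), mul_zero]
            · rw [mul_zero]
    rw [pdu_iterate_DtBar, Finset.sum_congr rfl fun c' hc' => Finset.sum_congr rfl (term c' hc')]
    have h0 : Coord.u j ⟨0, by omega⟩ K ∉ supp (F l) → pdu j 0 K (F l) = 0 := fun hn => by
      rw [pdu, dif_pos (by omega)]; exact pd_eq_zero_of_notMem_supp hn
    by_cases hmem : Coord.u j ⟨0, by omega⟩ K ∈ supp (F l)
    · rw [Finset.sum_eq_single_of_mem _ hmem fun b _ hb => by simp [hb],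
        Finset.sum_eq_single_of_mem p (by simp) fun b _ hb => by simp [hb], if_pos rfl, if_pos rfl]
    · rw [h0 hmem]
      simp

include hF hN hFN in
theorem lexLE_iterate_DtBar_rhs {p : ℕ} (hp : p < h) (l : Fin m) :
    LexLE N p ((DtBar F)^[p] (F l)) := by
  intro k s K hK
  rw [pdu_iterate_DtBar_rhs hF hN hFN p hp l k s K (by omega) (by omega)]
  split_ifs
  · exact hFN l k 0 K (by omega)
  · rfl

include hF hN hFN in
-- During at most `h` time steps a coordinate passes through the equation at most once, after which
-- fewer than `h` steps remain. This is why the space order grows by `N` only, and the remaining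
-- steps $s'+i-h$ bound the time order of the top part.
theorem pdu_iterate_DtBar_u_eq_zero {i : ℕ} (hi : i ≤ h) (l j : Fin m) (s : ℕ) (s' : Fin h)
    (I K : Fin n →₀ ℕ) (hK : I.degree + N ≤ K.degree)
    (hs : I.degree + N < K.degree ∨ s' + i < h + s) :
    pdu j s K ((DtBar F)^[i] (coordFn (Coord.u l s' I))) = 0 := by
  have := s'.2
  rw [iterate_DtBar_coordFn_u, resCoord]
  split_ifs with hlt
  · refine pdu_coordFn_u_of_ne ?_
    rintro ⟨-, -, rfl⟩
    omega
  · exact (lexLE_iterate_DtBar_rhs hF hN hFN (p := s' + i - h) (by omega) l).apply_DxI I j s K (by omega)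

theorem OrdLE.degree_le {a : ℕ} {f : SmoothFn U} (hf : OrdLE a f) {k : Fin m} {s : Fin h}
    {I : Fin n →₀ ℕ} (hc : Coord.u k s I ∈ supp f) : I.degree ≤ a := by
  by_contra hlt
  have := mem_supp.1 hc
  rw [← pdu_val] at this
  exact this (hf k s I (by omega))

theorem LexLE.time_le {a b : ℕ} {f : SmoothFn U} (hf : LexLE a b f) {k : Fin m} {s : Fin h}
    {I : Fin n →₀ ℕ} (hc : Coord.u k s I ∈ supp f) (hI : I.degree = a) : s ≤ b := by
  by_contra hlt
  have := mem_supp.1 hc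
  rw [← pdu_val] at this
  exact this (hf k s I (Or.inr ⟨hI, by omega⟩))

include hF hN hFN in
theorem OrdLE.iterate_DtBar {a : ℕ} {f : SmoothFn U} (hf : OrdLE a f) {i : ℕ} (hi : i ≤ h) :
    OrdLE (a + N) ((DtBar F)^[i] f) := by
  intro k s K hK
  rw [pdu_iterate_DtBar]
  refine Finset.sum_eq_zero fun c' hc' => Finset.sum_eq_zero fun j hj => ?_
  have hj' := Finset.mem_range.1 hj
  cases c' with
  | t => rw [pdu_iterate_DtBar_t, mul_zero]
  | x q => rw [pdu_iterate_DtBar_x, mul_zero]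
  | u l s' I =>
    have hI := hf.degree_le hc'
    rw [pdu_iterate_DtBar_u_eq_zero hF hN hFN (by omega) l k s s' I K (by omega) (by omega),
      mul_zero]

include hF hN hFN in
-- With $i<h$, a coordinate of `f` of space order `a` has time order $s'\le b$, so at space order
-- $a+N$ it can only reach time orders up to $s'+i-h$, which is below `b`; coordinates of smaller
-- space order do not reach $a+N$.
theorem LexLE.pdu_iterate_DtBar_coordFn {a b : ℕ} {f : SmoothFn U} (hf : LexLE a b f)
    {i : ℕ} (hi : i < h) (k : Fin m) (K : Fin n →₀ ℕ) (hK : K.degree = a + N)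
    {c : Coord n m (Fin h)} (hc : c ∈ supp f) :
    pdu k b K ((DtBar F)^[i] (coordFn c)) = 0 := by
  cases c with
  | t => rw [pdu_iterate_DtBar_t]
  | x q => rw [pdu_iterate_DtBar_x]
  | u l s' I =>
    have hI := hf.ordLE.degree_le hc
    refine pdu_iterate_DtBar_u_eq_zero hF hN hFN hi.le l k b s' I K (by omega) ?_
    rcases hI.lt_or_eq with h1 | h1
    · left; omega
    · right
      have := hf.time_le hc h1
      omega

include hF hN hFN in
theorem LexLE.pdu_iterate_DtBar_of_lt {a b : ℕ} {f : SmoothFn U} (hf : LexLE a b f) {i : ℕ}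
    (hi : i < h) (k : Fin m) (K : Fin n →₀ ℕ) (hK : K.degree = a + N) :
    pdu k b K ((DtBar F)^[i] f) = 0 := by
  rw [pdu_iterate_DtBar]
  refine Finset.sum_eq_zero fun c' hc' => Finset.sum_eq_zero fun j hj => ?_
  rw [hf.pdu_iterate_DtBar_coordFn hF hN hFN (by have := Finset.mem_range.1 hj; omega) k K hK hc',
    mul_zero]

include hF hN hFN in
-- Only the terms with all `h` time derivatives on a coordinate survive, and of these only the
-- coordinates $u^l_{b,I}$, $|I|=a$: smaller space order falls short of $a+N$, smaller time order
-- falls short of `b`.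
theorem LexLE.pdu_iterate_DtBar_top {a b : ℕ} (hb : b < h) {f : SmoothFn U} (hf : LexLE a b f)
    (k : Fin m) (K : Fin n →₀ ℕ) (hK : K.degree = a + N) :
    pdu k b K ((DtBar F)^[h] f) = ∑ l, ∑ I ∈ Finset.finsuppAntidiag Finset.univ a,
      pdu l b I f * pdu k b K (DxI I ((DtBar F)^[b] (F l))) := by
  classical
  have h1 : pdu k b K ((DtBar F)^[h] f) =
      ∑ c ∈ supp f, pd c f * pdu k b K ((DtBar F)^[h] (coordFn c)) := by
    rw [pdu_iterate_DtBar]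
    refine Finset.sum_congr rfl fun c hc => ?_
    rw [Finset.sum_range_succ, Finset.sum_eq_zero fun j hj => ?_, zero_add, Nat.choose_self,
      Nat.cast_one, one_mul, Nat.sub_self]
    · rfl
    · rw [hf.pdu_iterate_DtBar_coordFn hF hN hFN (Finset.mem_range.1 hj) k K hK hc, mul_zero]
  set T : Coord n m (Fin h) → SmoothFn U :=
    fun c => pd c f * pdu k b K ((DtBar F)^[h] (coordFn c)) with hT
  let e : Fin m × (Fin n →₀ ℕ) → Coord n m (Fin h) := fun q => Coord.u q.1 ⟨b, hb⟩ q.2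
  have he : Function.Injective e := by
    rintro ⟨l, I⟩ ⟨l', I'⟩ hq
    simpa [e] using hq
  have h2 : ∑ c ∈ supp f, T c =
      ∑ c ∈ (Finset.univ ×ˢ Finset.finsuppAntidiag Finset.univ a).image e, T c := by
    rw [← finsum_eq_sum_of_support_subset T (s := supp f) ?_,
      ← finsum_eq_sum_of_support_subset T ?_]
    · intro c hc
      have hcs : c ∈ supp f := mem_supp.2 fun h0 => hc (by simp only [hT, h0, zero_mul])
      have hc2 : pdu k b K ((DtBar F)^[h] (coordFn c)) ≠ 0 :=
        fun h0 => hc (by simp only [hT, h0, mul_zero])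
      cases c with
      | t => exact absurd (pdu_iterate_DtBar_t F k b K h) hc2
      | x q => exact absurd (pdu_iterate_DtBar_x F k b K q h) hc2
      | u l s' I =>
        have hI := hf.ordLE.degree_le hcs
        have hIa : I.degree = a := by
          by_contra hne
          exact hc2 (pdu_iterate_DtBar_u_eq_zero hF hN hFN le_rfl l k b s' I K (by omega)
            (by omega))
        have hsb : (s' : ℕ) = b := by
          by_contra hne
          have := hf.time_le hcs hIa
          exact hc2 (pdu_iterate_DtBar_u_eq_zero hF hN hFN le_rfl l k b s' I K (by omega)
            (by omega))
        rw [Finset.mem_coe, Finset.mem_image]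
        refine ⟨(l, I), Finset.mem_product.2 ⟨Finset.mem_univ _, mem_finsuppAntidiag_univ.2 hIa⟩, ?_⟩
        simp only [e, Coord.u.injEq, true_and, and_true]
        exact Fin.ext hsb.symm
    · intro c hc
      exact mem_supp.2 fun h0 => hc (by simp only [hT, h0, zero_mul])
  rw [h1, h2, Finset.sum_image he.injOn, Finset.sum_product]
  refine Finset.sum_congr rfl fun l _ => Finset.sum_congr rfl fun I _ => ?_
  simp only [hT, e]
  rw [iterate_DtBar_coordFn_u, resCoord, dif_neg (by simp), ← pdu_val]
  simp

include hF hN hFN in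
/-- The top part of `D̄_t^h f` is the product of the top part of `f` and the symbol of `F`. -/
theorem LexLE.sym_iterate_DtBar {a b : ℕ} (hb : b < h) {f : SmoothFn U} (hf : LexLE a b f)
    (j : Fin m) :
    sym (a + N) b j ((DtBar F)^[h] f) = ∑ l, sym a b l f * sym N 0 j (F l) := by
  have h1 : sym (a + N) b j ((DtBar F)^[h] f) =
      ∑ l, ∑ I ∈ Finset.finsuppAntidiag Finset.univ a,
        MvPolynomial.C (pdu l b I f) * sym (a + N) b j (DxI I ((DtBar F)^[b] (F l))) := by
    simp only [sym, Finset.mul_sum, MvPolynomial.C_mul_monomial]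
    rw [Finset.sum_congr rfl fun l _ => Finset.sum_comm, Finset.sum_comm]
    refine Finset.sum_congr rfl fun K hK => ?_
    rw [hf.pdu_iterate_DtBar_top hF hN hFN hb j K (mem_finsuppAntidiag_univ.1 hK)]
    simp only [map_sum]
  rw [h1]
  refine Finset.sum_congr rfl fun l _ => ?_
  rw [show sym a b l f = ∑ I ∈ Finset.finsuppAntidiag Finset.univ a,
    MvPolynomial.monomial I (pdu l b I f) from rfl, Finset.sum_mul]
  refine Finset.sum_congr rfl fun I hI => ?_
  have hI' := mem_finsuppAntidiag_univ.1 hI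
  rw [← hI', add_comm I.degree N, sym_DxI (lexLE_iterate_DtBar_rhs hF hN hFN hb l).ordLE,
    ← mul_assoc, MvPolynomial.C_mul_monomial, mul_one]
  congr 1
  refine sym_congr fun K hK => ?_
  rw [pdu_iterate_DtBar_rhs hF hN hFN b hb l j b K hK.ge (Or.inr le_rfl), if_pos rfl]

end TimeDerivatives

end OrderEstimates

/-! ### Existence and uniqueness of the normal form of $L$. -/

section NormalForms

variable {n m h : ℕ} {U : TopologicalSpace.Opens (Coord n m (Fin h) → ℝ)}

section OrderClosure

theorem OrdLE.mono {a b : ℕ} (hab : a ≤ b) {f : SmoothFn U} (hf : OrdLE a f) : OrdLE b f :=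
  fun k s K hK => hf k s K (by omega)

theorem ordLE_zero (a : ℕ) : OrdLE a (0 : SmoothFn U) := fun k s K _ => pdu_zero k s K

theorem OrdLE.add {a : ℕ} {f g : SmoothFn U} (hf : OrdLE a f) (hg : OrdLE a g) :
    OrdLE a (f + g) := fun k s K hK => by
  rw [← pduD_apply, map_add, pduD_apply, pduD_apply, hf k s K hK, hg k s K hK, add_zero]

theorem OrdLE.mul {a : ℕ} {f g : SmoothFn U} (hf : OrdLE a f) (hg : OrdLE a g) :
    OrdLE a (f * g) := fun k s K hK => by
  rw [pdu_mul, hf k s K hK, hg k s K hK, mul_zero, mul_zero, add_zero]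

theorem ordLE_sum {α : Type*} {a : ℕ} {S : Finset α} {f : α → SmoothFn U}
    (hf : ∀ i ∈ S, OrdLE a (f i)) : OrdLE a (∑ i ∈ S, f i) := fun k s K hK => by
  rw [pdu_sum]
  exact Finset.sum_eq_zero fun i hi => hf i hi k s K hK

theorem ordLE_intCast (a : ℕ) (q : ℤ) : OrdLE a (q : SmoothFn U) := fun k s K _ => by
  rw [← pduD_apply, Derivation.map_intCast]

theorem ordLE_neg_one_pow (a q : ℕ) : OrdLE a ((-1) ^ q : SmoothFn U) := by
  simpa using ordLE_intCast (U := U) a ((-1) ^ q)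

theorem ordLE_natCast (a q : ℕ) : OrdLE a (q : SmoothFn U) := by
  simpa using ordLE_intCast (U := U) a q

theorem pdu_comm (k k' : Fin m) (s s' : ℕ) (K K' : Fin n →₀ ℕ) (f : SmoothFn U) :
    pdu k s K (pdu k' s' K' f) = pdu k' s' K' (pdu k s K f) := by
  by_cases hs : s < h <;> by_cases hs' : s' < h
  · simp only [pdu, dif_pos hs, dif_pos hs']
    exact pd_comm _ _ _
  · rw [pdu_of_le (not_lt.1 hs'), pdu_of_le (not_lt.1 hs'), pdu_zero]
  · rw [pdu_of_le (not_lt.1 hs), pdu_of_le (not_lt.1 hs), pdu_zero]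
  · rw [pdu_of_le (not_lt.1 hs), pdu_of_le (not_lt.1 hs), pdu_zero]

theorem OrdLE.apply_pdu {a : ℕ} {f : SmoothFn U} (hf : OrdLE a f) (k : Fin m) (s : ℕ)
    (K : Fin n →₀ ℕ) : OrdLE a (pdu k s K f) := fun k' s' K' hK' => by
  rw [pdu_comm, hf k' s' K' hK', pdu_zero]

end OrderClosure

/-- The multi-indices of degree at most `N`. -/
def lowIdx (n N : ℕ) : Finset (Fin n →₀ ℕ) :=
  (Finset.range (N + 1)).biUnion fun a => Finset.finsuppAntidiag Finset.univ a

theorem mem_lowIdx {N : ℕ} {I : Fin n →₀ ℕ} : I ∈ lowIdx n N ↔ I.degree ≤ N := by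
  simp only [lowIdx, Finset.mem_biUnion, mem_finsuppAntidiag_univ, Finset.mem_range]
  constructor
  · rintro ⟨a, ha, rfl⟩; omega
  · intro hI; exact ⟨_, by omega, rfl⟩

section Existence

/-- The operator `ψ ↦ D_x^I (f ψ)` as a combination of the operators `D_x^J`. -/
theorem exists_DxI_mul_expansion {a : ℕ} {f : SmoothFn U} (hf : OrdLE a f) (I : Fin n →₀ ℕ) :
    ∃ p : (Fin n →₀ ℕ) →₀ SmoothFn U,
      (∀ ψ, DxI I (f * ψ) = p.sum fun J c => c * DxI J ψ) ∧
      (∀ J, I.degree < J.degree → p J = 0) ∧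
      (∀ J, J.degree = I.degree → J ≠ I → p J = 0) ∧ p I = f ∧
      ∀ J, OrdLE (a + I.degree) (p J) := by
  classical
  induction I using multiIndex_induction with
  | h0 =>
    refine ⟨Finsupp.single 0 f, fun ψ => ?_, fun J hJ => ?_, fun J _ hJ => ?_, by simp,
      fun J => ?_⟩
    · rw [Finsupp.sum_single_index (zero_mul _), DxI_zero_index, DxI_zero_index]
    · rw [Finsupp.single_eq_of_ne]
      rintro rfl
      omega
    · rw [Finsupp.single_eq_of_ne hJ]
    · rw [Finsupp.single_apply, map_zero, add_zero]
      split_ifs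
      · exact hf
      · exact ordLE_zero a
  | hs I j ih =>
    obtain ⟨p, hp, hdeg, htop, hI, hord⟩ := ih
    have hinj : Function.Injective fun J : Fin n →₀ ℕ => J + Finsupp.single j 1 :=
      add_left_injective _
    -- By the product rule, $D_{x_j}$ either differentiates a coefficient or raises its multi-index.
    set p' := p.mapRange (Dx j) (Dx_zero j) + p.mapDomain (· + Finsupp.single j 1) with hp'
    have hz : ∀ J, J j = 0 → p' J = Dx j (p J) := by
      intro J hJ
      rw [hp', Finsupp.add_apply, Finsupp.mapRange_apply, Finsupp.mapDomain_of_notMem_range,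
        add_zero]
      rintro ⟨J', rfl⟩
      simp at hJ
    have hsucc : ∀ J, p' (J + Finsupp.single j 1) = Dx j (p (J + Finsupp.single j 1)) + p J := by
      intro J
      rw [hp', Finsupp.add_apply, Finsupp.mapRange_apply]
      congr 1
      exact Finsupp.mapDomain_apply hinj p J
    refine ⟨p', fun ψ => ?_, fun J hJ => ?_, fun J hJ hne => ?_, ?_, fun J => ?_⟩
    · rw [DxI_add_single, hp, hp', Finsupp.sum_add_index' (fun _ => zero_mul _)
        (fun _ _ _ => add_mul _ _ _), Finsupp.sum_mapRange_index (fun _ => zero_mul _),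
        Finsupp.sum_mapDomain_index (fun _ => zero_mul _) (fun _ _ _ => add_mul _ _ _),
        Finsupp.sum, Finsupp.sum, Finsupp.sum, ← dxD_apply, map_sum (dxD j),
        ← Finset.sum_add_distrib]
      refine Finset.sum_congr rfl fun J _ => ?_
      rw [dxD_apply, Dx_mul, DxI_add_single]
      ring
    · rw [degree_add_single] at hJ
      by_cases hj : J j = 0
      · rw [hz J hj, hdeg J (by omega), Dx_zero]
      · obtain ⟨J, rfl⟩ := exists_eq_add_single hj
        rw [degree_add_single] at hJ
        rw [hsucc, hdeg _ (by rw [degree_add_single]; omega), hdeg J (by omega), Dx_zero, add_zero]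
    · rw [degree_add_single] at hJ
      by_cases hj : J j = 0
      · rw [hz J hj, hdeg J (by omega), Dx_zero]
      · obtain ⟨J, rfl⟩ := exists_eq_add_single hj
        rw [degree_add_single] at hJ
        rw [hsucc, hdeg _ (by rw [degree_add_single]; omega),
          htop J (by omega) (fun e => hne (by rw [e])), Dx_zero, add_zero]
    · rw [hsucc, hdeg _ (by rw [degree_add_single]; omega), hI, Dx_zero, zero_add]
    · rw [degree_add_single, ← add_assoc]
      by_cases hj : J j = 0
      · rw [hz J hj]
        exact (hord J).apply_Dx j
      · obtain ⟨J, rfl⟩ := exists_eq_add_single hj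
        rw [hsucc]
        exact ((hord _).apply_Dx j).add ((hord J).mono (by omega))

variable {F : Fin m → SmoothFn U} {N : ℕ}

theorem iterate_DtBar_mul (F : Fin m → SmoothFn U) (i : ℕ) (x y : SmoothFn U) :
    (DtBar F)^[i] (x * y) =
      ∑ j ∈ Finset.range (i + 1), i.choose j * (DtBar F)^[i - j] x * (DtBar F)^[j] y := by
  rw [← coe_dtbD]
  exact iterate_derivation_mul (dtbD F) i x y

theorem finsum_eq_sum_lowIdx {c : (Fin n →₀ ℕ) → SmoothFn U}
    (hc : ∀ I, N < I.degree → c I = 0) : ∑ᶠ I, c I = ∑ I ∈ lowIdx n N, c I :=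
  finsum_eq_sum_of_support_subset _ fun I hI => by
    rw [Finset.mem_coe, mem_lowIdx]
    by_contra hlt
    exact hI (hc I (by omega))

/-- The zeroth order terms of the Leibniz expansions are split off, since in the normal form they
belong to the coefficient $f_0$. -/
theorem sum_Ico_iterate_DtBar_mul (F : Fin m → SmoothFn U) (c : ℕ → SmoothFn U) (ψ : SmoothFn U) :
    ∑ s ∈ Finset.Ico 1 h, (-1) ^ s * (DtBar F)^[s] (c s * ψ) =
      (∑ s ∈ Finset.Ico 1 h, (-1) ^ s * (DtBar F)^[s] (c s)) * ψ +
        ∑ r ∈ Finset.Ico 1 h, (∑ s ∈ Finset.Ico 1 h,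
          (-1) ^ s * (s.choose r * (DtBar F)^[s - r] (c s))) * (DtBar F)^[r] ψ := by
  simp only [Finset.sum_mul]
  rw [Finset.sum_comm, ← Finset.sum_add_distrib]
  refine Finset.sum_congr rfl fun s hs => ?_
  have hs' := Finset.mem_Ico.1 hs
  have h1 : ∑ r ∈ Finset.range (s + 1), s.choose r * (DtBar F)^[s - r] (c s) * (DtBar F)^[r] ψ =
      ∑ r ∈ Finset.range h, s.choose r * (DtBar F)^[s - r] (c s) * (DtBar F)^[r] ψ := by
    refine Finset.sum_subset (Finset.range_subset_range.2 (by omega)) fun r _ hr => ?_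
    rw [Finset.mem_range] at hr
    rw [Nat.choose_eq_zero_of_lt (by omega), Nat.cast_zero, zero_mul, zero_mul]
  rw [iterate_DtBar_mul, h1, Finset.range_eq_Ico, Finset.sum_eq_sum_Ico_succ_bot (by omega),
    mul_add, Finset.mul_sum]
  congr 1
  · simp [mul_assoc]
  · exact Finset.sum_congr rfl fun r _ => by ring

/-- Besides existence it records what the theorem uses: for $|I|=N$ the coefficients are
undifferentiated derivatives of `F`, and all orders are at most $2N$, as up to $N$ space
derivatives, or fewer than $h$ time derivatives, add at most $N$ to the order of $\partial F$. -/
theorem exists_isNormalForm (hF : IsGenEvolution F) (hN : 0 < N) (hFN : ∀ l, OrdLE N (F l)) :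
    ∃ C : OpCoeffs U, IsNormalForm F N C ∧
      (∀ i j I, I.degree = N → C.f i j I = (-1) ^ N * pdu i 0 I (F j)) ∧
      (∀ i j I, OrdLE (N + N) (C.f i j I)) ∧ ∀ i j s, OrdLE (N + N) (C.g i j s) := by
  classical
  choose p hp hdeg htop hI hord using fun (i j : Fin m) (I : Fin n →₀ ℕ) =>
    exists_DxI_mul_expansion ((hFN j).apply_pdu i 0 I) I
  let cf : Fin m → Fin m → (Fin n →₀ ℕ) → SmoothFn U := fun i j J =>
    (∑ I ∈ lowIdx n N, (-1) ^ I.degree * p i j I J) +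
      if J = 0 then ∑ s ∈ Finset.Ico 1 h, (-1) ^ s * (DtBar F)^[s] (pdu i s 0 (F j)) else 0
  let cg : Fin m → Fin m → ℕ → SmoothFn U := fun i j r =>
    if r ∈ Finset.Ico 1 h then ∑ s ∈ Finset.Ico 1 h,
      (-1) ^ s * (s.choose r * (DtBar F)^[s - r] (pdu i s 0 (F j))) else 0
  have hcf : ∀ i j J, N < J.degree → cf i j J = 0 := by
    intro i j J hJ
    have hJ0 : J ≠ 0 := by
      rintro rfl
      simp at hJ
    simp only [cf, if_neg hJ0, add_zero]
    refine Finset.sum_eq_zero fun I hI' => ?_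
    rw [mem_lowIdx] at hI'
    rw [hdeg i j I J (by omega), mul_zero]
  have hD : ∀ i j s r, r < h → OrdLE (N + N) ((DtBar F)^[r] (pdu i s 0 (F j))) :=
    fun i j s r hr => ((hFN j).apply_pdu i s 0).iterate_DtBar hF hN hFN hr.le
  refine ⟨⟨cf, cg⟩, ⟨hcf, fun i j s hs => if_neg hs, fun i j ψ => ?_⟩, fun i j J hJ => ?_,
    fun i j J => ?_, fun i j r => ?_⟩
  · change adjL F i j ψ = (∑ᶠ I, cf i j I * DxI I ψ) +
      ∑ s ∈ Finset.Ico 1 h, cg i j s * (DtBar F)^[s] ψ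
    rw [adjL, finsum_eq_sum_lowIdx (N := N) fun I hI => by
        rw [hFN j i 0 I hI, zero_mul, DxI_zero, mul_zero],
      finsum_eq_sum_lowIdx (N := N) fun I hI => by rw [hcf i j I hI, zero_mul],
      sum_Ico_iterate_DtBar_mul, ← add_assoc]
    congr 1
    · simp only [cf, add_mul, Finset.sum_add_distrib, ite_mul, zero_mul]
      congr 1
      · simp only [Finset.sum_mul]
        rw [Finset.sum_comm]
        refine Finset.sum_congr rfl fun I hI' => ?_
        rw [hp, Finsupp.sum, Finset.mul_sum]
        have hsub : (p i j I).support ⊆ lowIdx n N := fun J hJ => by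
          rw [mem_lowIdx] at hI' ⊢
          by_contra hlt
          exact Finsupp.mem_support_iff.1 hJ (hdeg i j I J (by omega))
        refine Eq.trans ?_ (Finset.sum_subset hsub fun J _ hJ => ?_)
        · exact Finset.sum_congr rfl fun J _ => by ring
        · rw [Finsupp.notMem_support_iff.1 hJ, mul_zero, zero_mul]
      · rw [Finset.sum_ite_eq', if_pos (by simp [mem_lowIdx]), DxI_zero_index]
    · refine Finset.sum_congr rfl fun r hr => ?_
      simp only [cg, if_pos hr]
  -- As $N>0$, the correction at $J=0$ does not touch the top coefficients.
  · have hJ0 : J ≠ 0 := by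
      rintro rfl
      simp at hJ
      omega
    change cf i j J = _
    simp only [cf, if_neg hJ0, add_zero]
    rw [Finset.sum_eq_single_of_mem J (mem_lowIdx.2 hJ.le) fun I hI' hne => ?_, hI, hJ]
    rw [mem_lowIdx] at hI'
    rcases (hI'.trans hJ.ge).lt_or_eq with hlt | heq
    · rw [hdeg i j I J hlt, mul_zero]
    · rw [htop i j I J heq.symm hne.symm, mul_zero]
  · change OrdLE (N + N) (cf i j J)
    refine OrdLE.add (ordLE_sum fun I hI' => (ordLE_neg_one_pow _ _).mul
      ((hord i j I J).mono ?_)) ?_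
    · rw [mem_lowIdx] at hI'
      omega
    · split_ifs
      · exact ordLE_sum fun s hs => (ordLE_neg_one_pow _ _).mul
          (hD i j s s (Finset.mem_Ico.1 hs).2)
      · exact ordLE_zero _
  · change OrdLE (N + N) (cg i j r)
    simp only [cg]
    split_ifs
    · refine ordLE_sum fun s hs => (ordLE_neg_one_pow _ _).mul ((ordLE_natCast _ _).mul
        (hD i j s (s - r) ?_))
      have := Finset.mem_Ico.1 hs
      omega
    · exact ordLE_zero _

end Existence

section Uniqueness

/-- Polynomials in the space variables. -/
def xPoly : MvPolynomial (Fin n) ℝ →ₐ[ℝ] SmoothFn U :=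
  MvPolynomial.aeval fun j => coordFn (Coord.x j)

theorem Dx_xPoly (j : Fin n) (p : MvPolynomial (Fin n) ℝ) :
    Dx j (xPoly p : SmoothFn U) = xPoly (MvPolynomial.pderiv j p) := by
  classical
  induction p using MvPolynomial.induction_on with
  | C a =>
    rw [MvPolynomial.pderiv_C, map_zero, ← dxD_apply, xPoly, MvPolynomial.aeval_C,
      Derivation.map_algebraMap]
  | add p q hp hq => rw [map_add, Dx_add, hp, hq, map_add, map_add]
  | mul_X p i hp =>
    rw [map_mul, Dx_mul, hp, Derivation.leibniz, map_add, smul_eq_mul, smul_eq_mul, map_mul,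
      map_mul, MvPolynomial.pderiv_X]
    congr 2
    simp only [xPoly, MvPolynomial.aeval_X, Dx_coordFn, dxW, Pi.single_apply]
    split_ifs <;> simp

theorem DtBar_xPoly (F : Fin m → SmoothFn U) (p : MvPolynomial (Fin n) ℝ) :
    DtBar F (xPoly p) = 0 := by
  induction p using MvPolynomial.induction_on with
  | C a => rw [← dtbD_apply, xPoly, MvPolynomial.aeval_C, Derivation.map_algebraMap]
  | add p q hp hq => rw [map_add, ← dtbD_apply, map_add, dtbD_apply, dtbD_apply, hp, hq, add_zero]
  | mul_X p i hp =>
    rw [map_mul, ← dtbD_apply, Derivation.leibniz, dtbD_apply, dtbD_apply, hp, smul_zero, add_zero,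
      xPoly, MvPolynomial.aeval_X, DtBar_coordFn, dtbW, smul_zero]

/-- The constant is zero exactly when some exponent is exceeded, so the truncated subtraction does
no harm. -/
theorem exists_DxI_xPoly_monomial (I J : Fin n →₀ ℕ) :
    ∃ c : ℝ, DxI I (xPoly (MvPolynomial.monomial J 1) : SmoothFn U) =
      xPoly (MvPolynomial.monomial (J - I) c) ∧ (c ≠ 0 ↔ I ≤ J) := by
  induction I using multiIndex_induction with
  | h0 => exact ⟨1, by rw [DxI_zero_index, tsub_zero], by simp⟩
  | hs I j ih =>
    obtain ⟨c, hc, hcI⟩ := ih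
    refine ⟨c * ((J - I) j : ℕ), ?_, ?_⟩
    · rw [DxI_add_single, hc, Dx_xPoly, MvPolynomial.pderiv_monomial, tsub_tsub]
    · rw [mul_ne_zero_iff, hcI, Nat.cast_ne_zero]
      constructor
      · rintro ⟨h1, h2⟩ i
        have := h1 i
        rw [Finsupp.tsub_apply] at h2
        rw [Finsupp.add_apply, Finsupp.single_apply]
        split_ifs with hij
        · subst hij; omega
        · omega
      · intro h1
        refine ⟨le_self_add.trans h1, ?_⟩
        have := h1 j
        rw [Finsupp.add_apply, Finsupp.single_eq_same] at this
        rw [Finsupp.tsub_apply]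
        omega

theorem iterate_DtBar_t_pow (F : Fin m → SmoothFn U) (r s : ℕ) :
    (DtBar F)^[s] (coordFn Coord.t ^ r) =
      (r.descFactorial s : SmoothFn U) * coordFn Coord.t ^ (r - s) := by
  induction s with
  | zero => simp
  | succ s ih =>
    rw [Function.iterate_succ_apply', ih, ← dtbD_apply, derivation_natCast_mul,
      Derivation.leibniz_pow, dtbD_apply, DtBar_coordFn, dtbW, Nat.descFactorial_succ,
      nsmul_eq_mul, smul_eq_mul, mul_one, Nat.cast_mul, Nat.sub_sub]
    ring

theorem eq_zero_of_mul_algebraMap {f : SmoothFn U} {c : ℝ} (hc : c ≠ 0)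
    (hf : f * algebraMap ℝ (SmoothFn U) c = 0) : f = 0 := by
  rw [mul_comm, ← Algebra.smul_def] at hf
  have := congrArg (fun y => c⁻¹ • y) hf
  simpa [smul_smul, hc] using this

/-- An operator in normal form vanishes only if all of its coefficients do. -/
theorem coeffs_eq_zero (F : Fin m → SmoothFn U) {N : ℕ} {f : (Fin n →₀ ℕ) → SmoothFn U}
    {g : ℕ → SmoothFn U} (hfg : ∀ ψ, ∑ I ∈ lowIdx n N, f I * DxI I ψ +
      ∑ s ∈ Finset.Ico 1 h, g s * (DtBar F)^[s] ψ = 0) :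
    (∀ I ∈ lowIdx n N, f I = 0) ∧ ∀ s ∈ Finset.Ico 1 h, g s = 0 := by
  have hf : ∀ d, ∀ J ∈ lowIdx n N, J.degree = d → f J = 0 := by
    intro d
    induction d using Nat.strong_induction_on with
    | _ d ih =>
      rintro J hJ hd
      -- Testing on $x^J$: every $\bar D_t$ kills it, indices of lower degree are settled by
      -- induction, and among the others only $I=J$ satisfies $I\le J$.
      have h1 := hfg (xPoly (MvPolynomial.monomial J 1))
      rw [Finset.sum_eq_zero (s := Finset.Ico 1 h) fun s hs => ?_, add_zero,
        Finset.sum_eq_single_of_mem J hJ fun I hI hne => ?_] at h1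
      · obtain ⟨c, hc, hcJ⟩ := exists_DxI_xPoly_monomial (U := U) J J
        rw [hc, tsub_self] at h1
        refine eq_zero_of_mul_algebraMap (hcJ.2 le_rfl) ?_
        rw [← h1]
        congr 1
        exact (MvPolynomial.aeval_C _ c).symm
      · rcases lt_or_ge I.degree d with hlt | hge
        · rw [ih _ hlt I hI rfl, zero_mul]
        · obtain ⟨c, hc, hcI⟩ := exists_DxI_xPoly_monomial (U := U) I J
          have hc0 : c = 0 := by
            by_contra hc0
            obtain ⟨K, rfl⟩ := exists_add_of_le (hcI.1 hc0)
            rw [map_add] at hd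
            have hK : K = 0 := Finsupp.degree_eq_zero_iff K |>.1 (by omega)
            exact hne (by rw [hK, add_zero])
          rw [hc, hc0, map_zero, map_zero, mul_zero]
      · obtain ⟨s, rfl⟩ : ∃ r, s = r + 1 := ⟨s - 1, by have := Finset.mem_Ico.1 hs; omega⟩
        rw [Function.iterate_succ_apply, DtBar_xPoly, ← dtbPow_apply, map_zero, mul_zero]
  have hf' : ∀ I ∈ lowIdx n N, f I = 0 := fun I hI => hf _ I hI rfl
  refine ⟨hf', fun r => ?_⟩
  induction r using Nat.strong_induction_on with
  | _ r ih =>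
    intro hr
    -- Testing on $t^r$: $\bar D_t^st^r=0$ for $s>r$, and smaller $s$ are settled by induction.
    have h1 := hfg (coordFn Coord.t ^ r)
    rw [Finset.sum_eq_zero (s := lowIdx n N) fun I hI => by rw [hf' I hI, zero_mul], zero_add,
      Finset.sum_eq_single_of_mem r hr fun s hs hne => ?_] at h1
    · rw [iterate_DtBar_t_pow, Nat.sub_self, pow_zero, mul_one, Nat.descFactorial_self] at h1
      refine eq_zero_of_mul_algebraMap (c := (r.factorial : ℝ))
        (Nat.cast_ne_zero.2 r.factorial_ne_zero) ?_
      rw [map_natCast]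
      exact h1
    · rcases lt_or_gt_of_ne hne with hlt | hgt
      · rw [ih s hlt hs, zero_mul]
      · rw [iterate_DtBar_t_pow, Nat.descFactorial_of_lt hgt, Nat.cast_zero, zero_mul, mul_zero]

theorem IsNormalForm.unique {F : Fin m → SmoothFn U} {N : ℕ} {C C' : OpCoeffs U}
    (hC : IsNormalForm F N C) (hC' : IsNormalForm F N C') : C = C' := by
  obtain ⟨hf, hg, hop⟩ := hC
  obtain ⟨hf', hg', hop'⟩ := hC'
  have key : ∀ i j, (∀ I ∈ lowIdx n N, C.f i j I - C'.f i j I = 0) ∧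
      ∀ s ∈ Finset.Ico 1 h, C.g i j s - C'.g i j s = 0 := by
    intro i j
    refine coeffs_eq_zero F (N := N) (f := fun I => C.f i j I - C'.f i j I)
      (g := fun s => C.g i j s - C'.g i j s) fun ψ => ?_
    have h1 := hop i j ψ
    rw [hop' i j ψ, finsum_eq_sum_lowIdx (N := N) fun I hI => by rw [hf' i j I hI, zero_mul],
      finsum_eq_sum_lowIdx (N := N) fun I hI => by rw [hf i j I hI, zero_mul]] at h1
    simp only [sub_mul, Finset.sum_sub_distrib]
    rw [sub_add_sub_comm, ← h1, sub_self]
  have hff : C.f = C'.f := by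
    funext i j I
    by_cases hI : I ∈ lowIdx n N
    · exact sub_eq_zero.1 ((key i j).1 I hI)
    · rw [mem_lowIdx, not_le] at hI
      rw [hf i j I hI, hf' i j I hI]
  have hgg : C.g = C'.g := by
    funext i j s
    by_cases hs : s ∈ Finset.Ico 1 h
    · exact sub_eq_zero.1 ((key i j).2 s hs)
    · rw [hg i j s hs, hg' i j s hs]
  cases C
  cases C'
  simp only at hff hgg
  rw [hff, hgg]

end Uniqueness

end NormalForms

/-! ### Orders, symbols and the comparison of top parts. -/

section Symbols

variable {n m h : ℕ} {U : TopologicalSpace.Opens (Coord n m (Fin h) → ℝ)}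

section Order

variable {p : ℕ} {f : Fin p → SmoothFn U}

theorem finite_degree_set (f : Fin p → SmoothFn U) :
    {r : ℤ | ∃ i k s I, pdu k s I (f i) ≠ 0 ∧ r = (I.degree : ℤ)}.Finite := by
  refine Set.Finite.subset (Set.finite_iUnion fun i => Set.finite_iUnion fun k =>
    (finite_pdu_ne_zero k (f i)).image fun q => (q.2.degree : ℤ)) ?_
  rintro r ⟨i, k, s, I, hne, rfl⟩
  exact Set.mem_iUnion.2 ⟨i, Set.mem_iUnion.2 ⟨k, (s, I), hne, rfl⟩⟩

theorem degree_le_order {i : Fin p} {k : Fin m} {s : ℕ} {I : Fin n →₀ ℕ}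
    (hne : pdu k s I (f i) ≠ 0) : (I.degree : ℤ) ≤ order f :=
  le_csSup ((Set.finite_singleton _).union (finite_degree_set f)).bddAbove
    (Or.inr ⟨i, k, s, I, hne, rfl⟩)

theorem ordLE_of_order_le {a : ℕ} (hf : order f ≤ a) (i : Fin p) : OrdLE a (f i) := by
  intro k s K hK
  by_contra hne
  have := degree_le_order hne
  omega

theorem order_le_of_ordLE {a : ℕ} (hf : ∀ i, OrdLE a (f i)) : order f ≤ a := by
  refine csSup_le ⟨-1, Or.inl rfl⟩ ?_
  rintro r (rfl | ⟨i, k, s, I, hne, rfl⟩)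
  · omega
  · by_contra hlt
    exact hne (hf i k s I (by omega))

theorem tOrder_lt (hh : 0 < h) (f : Fin p → SmoothFn U) : tOrder f < h := by
  unfold tOrder
  rcases Set.eq_empty_or_nonempty
    {s : ℕ | ∃ i k I, pdu k s I (f i) ≠ 0 ∧ (I.degree : ℤ) = order f} with he | hne
  · rw [he]; simpa using hh
  · have hlt : ∀ s ∈ {s : ℕ | ∃ i k I, pdu k s I (f i) ≠ 0 ∧ (I.degree : ℤ) = order f}, s < h := by
      rintro s ⟨i, k, I, hs, -⟩
      by_contra hle
      exact hs (pdu_of_le (not_lt.1 hle) I (f i))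
    exact hlt _ (Nat.sSup_mem hne ⟨h, fun s hs => (hlt s hs).le⟩)

theorem le_tOrder {i : Fin p} {k : Fin m} {s : ℕ} {I : Fin n →₀ ℕ}
    (hne : pdu k s I (f i) ≠ 0) (hI : (I.degree : ℤ) = order f) : s ≤ tOrder f := by
  refine le_csSup ⟨h, ?_⟩ ⟨i, k, I, hne, hI⟩
  rintro s ⟨i, k, I, hs, -⟩
  by_contra hle
  exact hs (pdu_of_le (not_le.1 hle).le I (f i))

theorem lexLE_tOrder {a : ℕ} (ha : order f = a) (i : Fin p) : LexLE a (tOrder f) (f i) := by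
  rintro k s K (hK | ⟨hK, hs⟩)
  · exact ordLE_of_order_le ha.le i k s K hK
  · by_contra hne
    have := le_tOrder hne (by rw [hK, ha])
    omega

/-- Top derivatives of `F` have $|I|=N>0$, and mixed derivatives are excluded. -/
theorem IsGenEvolution.tOrder_eq_zero {F : Fin m → SmoothFn U} (hF : IsGenEvolution F)
    (hF0 : 0 < order F) : tOrder F = 0 := by
  rw [← Nat.le_zero]
  unfold tOrder
  refine csSup_le' ?_
  rintro s ⟨i, k, I, hne, hI⟩
  by_contra hs
  refine hne (hF i k s I (by omega) ?_)
  rintro rfl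
  simp at hI
  omega

end Order

section Sym

theorem sym_sum {α : Type*} (a b : ℕ) (j : Fin m) (S : Finset α) (f : α → SmoothFn U) :
    sym a b j (∑ i ∈ S, f i) = ∑ i ∈ S, sym a b j (f i) := by
  unfold sym
  rw [Finset.sum_comm]
  simp only [pdu_sum, map_sum]

theorem sym_add (a b : ℕ) (j : Fin m) (f g : SmoothFn U) :
    sym a b j (f + g) = sym a b j f + sym a b j g := by
  unfold sym
  simp only [← pduD_apply, map_add, Finset.sum_add_distrib]

/-- A factor of lower order behaves as a constant for the symbol at order `a`. The hypothesis
$\mathrm o(\chi)>O$ enters the argument in this way. -/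
theorem sym_mul_of_ordLE {a a' b : ℕ} (j : Fin m) {c : SmoothFn U} (hc : OrdLE a' c) (ha : a' < a)
    (f : SmoothFn U) : sym a b j (c * f) = MvPolynomial.C c * sym a b j f := by
  unfold sym
  rw [Finset.mul_sum]
  refine Finset.sum_congr rfl fun K hK => ?_
  rw [mem_finsuppAntidiag_univ] at hK
  rw [pdu_mul, hc j b K (by omega), mul_zero, add_zero, MvPolynomial.C_mul_monomial]

theorem sym_eq_zero {a b : ℕ} {j : Fin m} {f : SmoothFn U}
    (hf : ∀ K : Fin n →₀ ℕ, K.degree = a → pdu j b K f = 0) : sym a b j f = 0 :=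
  Finset.sum_eq_zero fun K hK => by rw [hf K (mem_finsuppAntidiag_univ.1 hK), map_zero]

end Sym

section Main

theorem eq_neg_one_pow_smul {R : Type*} [CommRing R] {x y : R} {p q : ℕ}
    (hxy : (-1) ^ q * x = (-1) ^ p * y) : x = (-1 : ℤ) ^ (p + q) • y := by
  have hx : x = (-1) ^ (p + q) * y := by
    rw [pow_add, mul_comm ((-1 : R) ^ p), mul_assoc, ← hxy, ← mul_assoc, ← pow_add,
      Even.neg_one_pow ⟨q, rfl⟩, one_mul]
  rw [hx]
  rcases Nat.even_or_odd (p + q) with he | ho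
  · rw [he.neg_one_pow, he.neg_one_pow, one_zsmul, one_mul]
  · rw [ho.neg_one_pow, ho.neg_one_pow, neg_one_zsmul, neg_one_mul]

variable {F : Fin m → SmoothFn U} {N : ℕ}

theorem order_sub_le_of_ordLE {f : SmoothFn U} (hf : OrdLE (N + N) f) : order ![f] - N ≤ N := by
  have := order_le_of_ordLE (f := ![f]) (a := N + N) (by simpa using hf)
  push_cast at this
  omega

theorem constO_set_le {C : OpCoeffs U} (hf : ∀ i j I, OrdLE (N + N) (C.f i j I))
    (hg : ∀ i j s, OrdLE (N + N) (C.g i j s)) :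
    ∀ r ∈ ({-1} ∪ {r : ℤ | ∃ i j I, r = order ![C.f i j I] - N} ∪
      {r : ℤ | ∃ i j s, r = order ![C.g i j s] - N}), r ≤ N := by
  rintro r ((rfl | ⟨i, j, I, rfl⟩) | ⟨i, j, s, rfl⟩)
  · omega
  · exact order_sub_le_of_ordLE (hf i j I)
  · exact order_sub_le_of_ordLE (hg i j s)

/-- The comparison of the top parts of both sides of the equation for a characteristic. -/
theorem symbol_identity (hF : IsGenEvolution F) (hN : 0 < N) (hFN : ∀ l, OrdLE N (F l))
    {C : OpCoeffs U} (hC : IsNormalForm F N C)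
    (htop : ∀ i j I, I.degree = N → C.f i j I = (-1) ^ N * pdu i 0 I (F j))
    {a b : ℕ} (hb : b < h)
    (hf : ∀ i j I, OrdLE (a + N - 1) (C.f i j I)) (hg : ∀ i j s, OrdLE (a + N - 1) (C.g i j s))
    {χ : Fin m → SmoothFn U} (hχ : ∀ i, LexLE a b (χ i))
    (heq : ∀ k, (-1) ^ h * (DtBar F)^[h] (χ k) = ∑ l, adjL F k l (χ l)) (i j : Fin m) :
    (-1) ^ h * ∑ l, sym a b l (χ i) * sym N 0 j (F l) =
      (-1) ^ N * ∑ l, sym N 0 i (F l) * sym a b j (χ l) := by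
  have hlow : a + N - 1 < a + N := by omega
  have h1 := congrArg (sym (a + N) b j) (heq i)
  rw [sym_mul_of_ordLE j (ordLE_neg_one_pow (a + N - 1) h) hlow,
    (hχ i).sym_iterate_DtBar hF hN hFN hb j, map_pow, map_neg, map_one] at h1
  rw [h1, sym_sum, Finset.mul_sum]
  refine Finset.sum_congr rfl fun l _ => ?_
  rw [hC.2.2 i l (χ l), finsum_eq_sum_lowIdx (N := N) fun I hI => by
    rw [hC.1 i l I hI, zero_mul], sym_add, sym_sum, sym_sum]
  -- The terms with $\bar D_t^s$, $s<h$, do not reach space order $a+N$ at time order `b`.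
  rw [Finset.sum_eq_zero (s := Finset.Ico 1 h) fun s hs => ?_, add_zero]
  · have hsub : Finset.finsuppAntidiag Finset.univ N ⊆ lowIdx n N := fun I hI =>
      mem_lowIdx.2 (mem_finsuppAntidiag_univ.1 hI).le
    -- For $|I|<N$ the function $\bar D_x^I\chi_l$ has space order below $a+N$.
    rw [← Finset.sum_subset hsub fun I hI hI' => ?_]
    · rw [show sym N 0 i (F l) = ∑ I ∈ Finset.finsuppAntidiag Finset.univ N,
        MvPolynomial.monomial I (pdu i 0 I (F l)) from rfl, Finset.sum_mul, Finset.mul_sum]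
      refine Finset.sum_congr rfl fun I hI => ?_
      have hIN := mem_finsuppAntidiag_univ.1 hI
      have hD := sym_DxI (hχ l).ordLE b j I
      rw [hIN] at hD
      rw [sym_mul_of_ordLE j (hf i l I) hlow, hD, htop i l I hIN, map_mul, map_pow, map_neg,
        map_one, ← mul_one (pdu i 0 I (F l)), ← MvPolynomial.C_mul_monomial]
      ring_nf
    · rw [mem_lowIdx] at hI
      rw [mem_finsuppAntidiag_univ] at hI'
      rw [sym_mul_of_ordLE j (hf i l I) hlow, sym_eq_zero fun K hK => ?_, mul_zero]
      exact (hχ l).ordLE.apply_DxI I j b K (by omega)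
  · rw [sym_mul_of_ordLE j (hg i l s) hlow, sym_eq_zero fun K hK => ?_, mul_zero]
    exact (hχ l).pdu_iterate_DtBar_of_lt hF hN hFN (Finset.mem_Ico.1 hs).2 j K hK

end Main

end Symbols

end JetCons

end

/-! ### The theorem. -/

open JetCons in
theorem theorem1 {n m h N : ℕ} (hh : 0 < h)
    (U : TopologicalSpace.Opens (Coord n m (Fin h) → ℝ))
    (F : Fin m → SmoothFn U) (hF : IsGenEvolution F)
    (hN : 0 < N) (hFN : order F = (N : ℤ)) :
    (∃! C : OpCoeffs U, IsNormalForm F N C) ∧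
    ∀ C : OpCoeffs U, IsNormalForm F N C →
      constO N C ≤ N ∧
      ∀ (J₀ : SmoothFn U) (J : Fin n → SmoothFn U) (χ : Fin m → SmoothFn U),
        IsConservedCurrent F J₀ J → IsCharacteristic F J₀ J χ →
        constO N C < order χ →
        symbol χ * symbol F = (-1 : ℤ) ^ (N + h) • ((symbol F).transpose * symbol χ) := by
  have hFord : ∀ l, OrdLE N (F l) := ordLE_of_order_le hFN.le
  obtain ⟨C₀, hC₀, htop, hf, hg⟩ := exists_isNormalForm hF hN hFord
  refine ⟨⟨C₀, hC₀, fun C hC => hC.unique hC₀⟩, fun C hC => ?_⟩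
  obtain rfl : C = C₀ := hC.unique hC₀
  have hbound := constO_set_le hf hg
  refine ⟨csSup_le ⟨-1, Or.inl (Or.inl rfl)⟩ hbound, fun J₀ J χ _ hχ hlt => ?_⟩
  -- Boundedness is needed for the supremum `constO` to dominate its members.
  have hbdd : BddAbove ({-1} ∪ {r : ℤ | ∃ i j I, r = order ![C.f i j I] - N} ∪
      {r : ℤ | ∃ i j s, r = order ![C.g i j s] - N}) := ⟨N, hbound⟩
  have hneg : -1 ≤ constO N C := le_csSup hbdd (Or.inl (Or.inl rfl))
  -- Since $O\ge-1$, the order of $\chi$ is nonnegative and its symbol is meaningful.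
  obtain ⟨a, ha⟩ : ∃ a : ℕ, order χ = a := ⟨(order χ).toNat, by omega⟩
  have hf' : ∀ i j I, OrdLE (a + N - 1) (C.f i j I) := fun i j I => by
    have hle : order ![C.f i j I] - N ≤ constO N C :=
      le_csSup hbdd (Or.inl (Or.inr ⟨i, j, I, rfl⟩))
    -- $\mathrm o(f_I)-N\le O<a$ for integers gives $\mathrm o(f_I)\le a+N-1$, where $N>0$ keeps the
    -- natural subtraction exact.
    exact ordLE_of_order_le (f := ![C.f i j I]) (by omega) 0
  have hg' : ∀ i j s, OrdLE (a + N - 1) (C.g i j s) := fun i j s => by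
    have hle : order ![C.g i j s] - N ≤ constO N C := le_csSup hbdd (Or.inr ⟨i, j, s, rfl⟩)
    exact ordLE_of_order_le (f := ![C.g i j s]) (by omega) 0
  have key := symbol_identity hF hN hFord hC htop (tOrder_lt hh χ) hf' hg' (lexLE_tOrder ha)
    (characteristic_equation F hF hχ)
  have htF : tOrder F = 0 := hF.tOrder_eq_zero (by omega)
  ext1 i j
  have hij := key i j
  rw [Matrix.smul_apply, Matrix.mul_apply, Matrix.mul_apply]
  simp only [symbol, Matrix.transpose_apply, symbolAt_apply, ha, hFN, htF, Int.toNat_natCast]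
  exact eq_neg_one_pow_smul (R := MvPolynomial (Fin n) (SmoothFn U)) hij
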